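/- **Setting.** For $\mathcal P=\{t_0<\dots<t_p\}\subseteq[0,1]$ with $p\ge 1$ let $\|\mathcal P\|_{\max}=\max_i(t_{i+1}-t_i)$ and $v_2(f,\mathcal P)=\big(\sum_{i<p}(f(t_{i+1})-f(t_i))^2\big)^{1/2}$. Let $V_2$ be the space of all $f:[0,1]\to\mathbb R$ with $f(0)=0$ and $\|f\|_{V_2}=\sup_{\mathcal P}v_2(f,\mathcal P)<\infty$, normed by $\|\cdot\|_{V_2}$, and let $V_2^0\subseteq V_2$ be the closed subspace of square absolutely continuous functions: for every $\varepsilon>0$ there is $\eta>0$ such that $\sum_i(f(b_i)-f(a_i))^2<\varepsilon$ for every finite family of non-overlapping intervals $[a_i,b_i]\subseteq[0,1]$ with $\sum_i(b_i-a_i)^2<\eta$. For a closed subspace $X\subseteq V_2^0$, the second dual $X^{**}$ is regarded as a subspace of $V_2$ by identifying $\Phi\in X^{**}$ with the function $t\mapsto\Phi(\delta_t)$, where $\delta_t\in X^*$ is evaluation at $t$. Let $\mathcal A$ be the set of all finite families $\mathcal I=(I_i)_{i=1}^k$ of intervals of $[0,1]$ (with or without their endpoints) with pairwise disjoint interiors;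 if $a_i\le b_i$ are the endpoints of $I_i$, put $v_2^2(f,\mathcal I)=\sum_{i=1}^k(f(b_i)-f(a_i))^2$ and $\cup\mathcal I=\bigcup_i I_i$. For $f\in V_2$ and an interval $I$ of $[0,1]$ put $\widetilde\mu_f(I)=\inf_{\eta>0}\sup\{v_2^2(f,\mathcal P):\mathcal P\subseteq I,\ \|\mathcal P\|_{\max}<\eta\}$, let $\widetilde F_f(x)=0$ for $x\le0$, $\widetilde F_f(x)=\widetilde\mu_f[0,x]$ for $0<x<1$ and $\widetilde F_f(x)=\widetilde\mu_f[0,1]$ for $x\ge1$, and let $\mu_f$ be the finite positive Borel measure with distribution function $F_f(x)=\widetilde F_f(x^+)$; it is concentrated on $[0,1]$ and regarded as a measure on $[0,1]$. Let $\mu_f^d$ be its discrete (atomic) part, and $\|\mu\|=\mu([0,1])$. Let $\widetilde{osc}_{[0,1]}f(t)=\inf_V\sup_{x\in V}|f(x)-f(t)|$, where $V$ runs over the open neighbourhoods of $t$ in $[0,1]$, and $\|\cdot\|_\infty$ the supremum norm. A function $G$ is $(C,\varepsilon)$-dominated by $\mu$ if $v_2^2(G,\mathcal I)\le C\mu(\cup\mathcal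 I)+\varepsilon$ for every $\mathcal I\in\mathcal A$. A convex block sequence of $(f_n)_n$ is a sequence $h_n=\sum_{i\in S_n}\lambda_if_i$ with finite sets $S_1<S_2<\cdots$ of indices, $\lambda_i\ge0$ and $\sum_{i\in S_n}\lambda_i=1$. **Proposition.** Let $X$ be a closed subspace of $V_2^0$, let $f\in X^{**}\setminus X$, and let $(f_n)_n$ be a bounded sequence in $X$ converging pointwise to $f$; put $M=\sup_n\|f_n\|_{V_2}$. Then for every $0<\delta<\operatorname{dist}(f,X)$ and every sequence $(\varepsilon_n)_n$ of positive real numbers there is a convex block sequence $(h_n)_n$ of $(f_n)_n$ such that for all $n<m$: 1. $\delta<\|h_m-h_n\|_{V_2}\le 2M$; 2. $\|h_m-h_n\|_\infty\le 2\|\widetilde{osc}_{[0,1]}f\|_\infty+\varepsilon_n\le 4\|f\|_\infty+\varepsilon_n$; 3. $h_m-h_n$ is $\big(4,\ 32\|f\|_{V_2}\sqrt{\|\mu_f^d\|}+\varepsilon_n\big)$-dominated by $\mu_f$. Moreover, for every index $k$, every $\theta>0$ and every open subset $V$ of $[0,1]$ with $\mu_f(V)>\theta$ there are $\mathcal J\in\mathcal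 A$ with $\cup\mathcal J\subseteq V$ and $l>k$ such that 4. $v_2^2(h_l-h_k,\mathcal J)>\theta$. -/

import Mathlib

open MeasureTheory Filter Topology Set
open scoped unitInterval

noncomputable section

namespace QuadVar

/-! ### Partitions, families of intervals and quadratic variation -/

/-- A finite set `{t₀ < t₁ < ⋯ < t_p}` of points of `[0,1]`, with `p ≥ 1`. -/
structure Partition where
  p : ℕ
  one_le : 1 ≤ p
  t : Fin (p + 1) → I
  strictMono : StrictMono t

/-- `v₂²(f, P) = ∑ (f(t_{i+1}) - f(t_i))²`. -/
def Partition.v2sq (f : I → ℝ) (P : Partition) : ℝ :=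
  ∑ i : Fin P.p, (f (P.t i.succ) - f (P.t i.castSucc)) ^ 2

/-- `‖P‖_max < δ`. -/
def Partition.MeshLT (P : Partition) (δ : ℝ) : Prop :=
  ∀ i : Fin P.p, (P.t i.succ : ℝ) - (P.t i.castSucc : ℝ) < δ

/-- `P ⊆ S`. -/
def Partition.Within (P : Partition) (S : Set I) : Prop := ∀ i, P.t i ∈ S

/-- A finite family of intervals of `[0,1]` with pairwise disjoint interiors.  The `i`-th interval
is the set `carrier i`; it has the endpoints `left i ≤ right i`, each of which it may or may not
contain. -/
structure IntervalFamily where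
  k : ℕ
  left : Fin k → I
  right : Fin k → I
  carrier : Fin k → Set I
  left_le_right : ∀ i, left i ≤ right i
  Ioo_subset : ∀ i, Ioo (left i) (right i) ⊆ carrier i
  subset_Icc : ∀ i, carrier i ⊆ Icc (left i) (right i)
  disjoint : ∀ i j, i ≠ j → Disjoint (Ioo (left i) (right i)) (Ioo (left j) (right j))

/-- `v₂²(f, 𝓘) = ∑ (f(b_i) - f(a_i))²`. -/
def IntervalFamily.v2sq (f : I → ℝ) (F : IntervalFamily) : ℝ :=
  ∑ i : Fin F.k, (f (F.right i) - f (F.left i)) ^ 2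

/-- The union of the intervals of the family. -/
def IntervalFamily.union (F : IntervalFamily) : Set I := ⋃ i, F.carrier i

lemma Partition.v2sq_nonneg (f : I → ℝ) (P : Partition) : 0 ≤ P.v2sq f :=
  Finset.sum_nonneg fun _ _ => sq_nonneg _

/-- The partition `{0 < 1}`. -/
def Partition.trivial : Partition where
  p := 1
  one_le := le_rfl
  t := ![0, 1]
  strictMono := by
    intro i j hij
    fin_cases i <;> fin_cases j <;> simp_all

instance : Nonempty Partition := ⟨Partition.trivial⟩

lemma Partition.sqrt_v2sq_add_le (f g : I → ℝ) (P : Partition) :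
    √(P.v2sq (f + g)) ≤ √(P.v2sq f) + √(P.v2sq g) := by
  have key : ∀ k : I → ℝ, √(P.v2sq k) =
      ‖(WithLp.toLp 2 (fun i : Fin P.p => k (P.t i.succ) - k (P.t i.castSucc)) :
        EuclideanSpace ℝ (Fin P.p))‖ := by
    intro k
    simp [EuclideanSpace.norm_eq, Partition.v2sq]
  rw [key, key, key]
  refine le_trans (le_of_eq ?_) (norm_add_le _ _)
  congr 1
  ext i
  simp only [Pi.add_apply, PiLp.add_apply]
  ring

lemma Partition.v2sq_smul (c : ℝ) (f : I → ℝ) (P : Partition) :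
    P.v2sq (c • f) = c ^ 2 * P.v2sq f := by
  simp only [Partition.v2sq, Finset.mul_sum, Pi.smul_apply, smul_eq_mul]
  exact Finset.sum_congr rfl fun i _ => by ring

/-! ### The spaces `V₂` and `V₂⁰` -/

/-- The functions `f : [0,1] → ℝ` of bounded quadratic variation with `f 0 = 0`. -/
def quadVarSubmodule : Submodule ℝ (I → ℝ) where
  carrier := {f | f 0 = 0 ∧ BddAbove (range fun P : Partition => √(P.v2sq f))}
  zero_mem' := by
    refine ⟨rfl, 0, ?_⟩
    rintro _ ⟨P, rfl⟩
    simp [Partition.v2sq]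
  add_mem' := by
    rintro f g ⟨hf, A, hA⟩ ⟨hg, B, hB⟩
    refine ⟨by simp [hf, hg], A + B, ?_⟩
    rintro _ ⟨P, rfl⟩
    exact (P.sqrt_v2sq_add_le f g).trans (add_le_add (hA ⟨P, rfl⟩) (hB ⟨P, rfl⟩))
  smul_mem' := by
    rintro c f ⟨hf, A, hA⟩
    refine ⟨by simp [hf], |c| * A, ?_⟩
    rintro _ ⟨P, rfl⟩
    simp only [Partition.v2sq_smul, Real.sqrt_mul (sq_nonneg c), Real.sqrt_sq_eq_abs]
    exact mul_le_mul_of_nonneg_left (hA ⟨P, rfl⟩) (abs_nonneg c)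

/-- The space `V₂`.  This is a type of its own, so that it carries the topology of the quadratic
variation norm and not that of pointwise convergence. -/
def V2 : Type := quadVarSubmodule

instance : AddCommGroup V2 := inferInstanceAs (AddCommGroup quadVarSubmodule)
instance : Module ℝ V2 := inferInstanceAs (Module ℝ quadVarSubmodule)

instance : FunLike V2 I ℝ where
  coe f := f.1
  coe_injective := Subtype.val_injective

@[ext] lemma V2.ext {f g : V2} (h : ∀ t, f t = g t) : f = g := DFunLike.ext _ _ h

@[simp] lemma V2.coe_add (f g : V2) : ⇑(f + g) = ⇑f + ⇑g := rfl
@[simp] lemma V2.coe_neg (f : V2) : ⇑(-f) = -⇑f := rfl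
@[simp] lemma V2.coe_sub (f g : V2) : ⇑(f - g) = ⇑f - ⇑g := rfl
@[simp] lemma V2.coe_zero : ⇑(0 : V2) = 0 := rfl
@[simp] lemma V2.coe_smul (c : ℝ) (f : V2) : ⇑(c • f) = c • ⇑f := rfl

@[simp] lemma V2.apply_zero (f : V2) : f 0 = 0 := f.2.1

lemma V2.bddAbove (f : V2) : BddAbove (range fun P : Partition => √(P.v2sq f)) := f.2.2

/-- The quadratic variation norm `‖f‖_{V₂} = sup_P v₂(f, P)`. -/
instance : Norm V2 := ⟨fun f => ⨆ P : Partition, √(P.v2sq f)⟩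

lemma V2.norm_def (f : V2) : ‖f‖ = ⨆ P : Partition, √(P.v2sq f) := rfl

lemma V2.sqrt_v2sq_le_norm (f : V2) (P : Partition) : √(P.v2sq f) ≤ ‖f‖ :=
  le_ciSup f.bddAbove P

lemma V2.v2sq_le (f : V2) (P : Partition) : P.v2sq f ≤ ‖f‖ ^ 2 :=
  Real.sqrt_le_iff.1 (f.sqrt_v2sq_le_norm P) |>.2

lemma V2.abs_apply_le_norm (f : V2) (t : I) : |f t| ≤ ‖f‖ := by
  rcases eq_or_lt_of_le (unitInterval.nonneg' : 0 ≤ t) with rfl | ht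
  · rw [f.apply_zero, abs_zero]
    exact (Real.sqrt_nonneg _).trans (f.sqrt_v2sq_le_norm Partition.trivial)
  · let P : Partition :=
      { p := 1
        one_le := le_rfl
        t := ![0, t]
        strictMono := by
          intro i j hij
          fin_cases i <;> fin_cases j <;> simp_all }
    have h := f.sqrt_v2sq_le_norm P
    have e : P.v2sq f = (f t) ^ 2 := by
      simp [Partition.v2sq, P]
    rwa [e, Real.sqrt_sq_eq_abs] at h

instance : NormedAddCommGroup V2 :=
  NormedAddCommGroup.ofCore (𝕜 := ℝ)
    { norm_nonneg := fun f => Real.iSup_nonneg fun _ => Real.sqrt_nonneg _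
      norm_smul := by
        intro c f
        simp only [V2.norm_def, V2.coe_smul, Partition.v2sq_smul, Real.sqrt_mul (sq_nonneg c),
          Real.sqrt_sq_eq_abs, Real.norm_eq_abs]
        exact (Real.mul_iSup_of_nonneg (abs_nonneg c) _).symm
      norm_triangle := fun f g => ciSup_le fun P => (P.sqrt_v2sq_add_le f g).trans
        (add_le_add (f.sqrt_v2sq_le_norm P) (g.sqrt_v2sq_le_norm P))
      norm_eq_zero_iff := by
        intro f
        constructor
        · intro h
          ext t
          simpa [h] using f.abs_apply_le_norm t
        · rintro rfl
          simp [V2.norm_def, Partition.v2sq] }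

instance : NormedSpace ℝ V2 where
  norm_smul_le c f := by
    simp only [V2.norm_def, V2.coe_smul, Partition.v2sq_smul, Real.sqrt_mul (sq_nonneg c),
      Real.sqrt_sq_eq_abs, Real.norm_eq_abs]
    exact (Real.mul_iSup_of_nonneg (abs_nonneg c) _).ge

/-- Square absolute continuity in the sense of Love: for every `ε > 0` there is `δ > 0` such that
`∑ (f(b_i) - f(a_i))² < ε` for all finite families of non-overlapping intervals with
`∑ (b_i - a_i)² < δ`. -/
def SquareAbsCont (f : I → ℝ) : Prop :=
  ∀ ε > 0, ∃ δ > 0, ∀ F : IntervalFamily, F.v2sq (fun t => (t : ℝ)) < δ → F.v2sq f < ε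

/-- The space `V₂⁰` of the square absolutely continuous functions in `V₂`. -/
def V20 : Submodule ℝ V2 where
  carrier := {f | SquareAbsCont f}
  zero_mem' := fun ε hε => ⟨1, one_pos, fun F _ => by simpa [IntervalFamily.v2sq] using hε⟩
  add_mem' := by
    intro f g hf hg ε hε
    obtain ⟨a, ha, hfa⟩ := hf (ε / 4) (by positivity)
    obtain ⟨b, hb, hgb⟩ := hg (ε / 4) (by positivity)
    refine ⟨min a b, lt_min ha hb, fun F hF => ?_⟩
    have h1 := hfa F (hF.trans_le (min_le_left _ _))
    have h2 := hgb F (hF.trans_le (min_le_right _ _))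
    have h3 : F.v2sq (f + g) ≤ 2 * F.v2sq f + 2 * F.v2sq g := by
      simp only [IntervalFamily.v2sq, Finset.mul_sum, ← Finset.sum_add_distrib]
      refine Finset.sum_le_sum fun i _ => ?_
      simp only [Pi.add_apply]
      nlinarith [sq_nonneg ((f (F.right i) - f (F.left i)) - (g (F.right i) - g (F.left i)))]
    rw [V2.coe_add]
    linarith
  smul_mem' := by
    intro c f hf ε hε
    obtain ⟨a, ha, hfa⟩ := hf (ε / (c ^ 2 + 1)) (by positivity)
    refine ⟨a, ha, fun F hF => ?_⟩
    have h1 := hfa F hF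
    have h2 : F.v2sq (c • f) = c ^ 2 * F.v2sq f := by
      simp only [IntervalFamily.v2sq, Finset.mul_sum, Pi.smul_apply, smul_eq_mul]
      exact Finset.sum_congr rfl fun i _ => by ring
    have h0 : 0 ≤ F.v2sq f := Finset.sum_nonneg fun _ _ => sq_nonneg _
    rw [lt_div_iff₀ (by positivity)] at h1
    rw [V2.coe_smul, h2]
    nlinarith

/-! ### The second dual of a subspace, as a subspace of `V₂` -/

/-- The evaluation functional `f ↦ f t` on `V₂`. -/
def evalCLM (t : I) : V2 →L[ℝ] ℝ :=
  LinearMap.mkContinuous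
    { toFun := fun f => f t
      map_add' := fun _ _ => rfl
      map_smul' := fun _ _ => rfl } 1
    fun f => (f.abs_apply_le_norm t).trans_eq (one_mul _).symm

/-- The second dual `X**` of a subspace `X`, regarded as a set of functions on `[0,1]`: an element
`Φ` of `X**` is identified with the function `t ↦ Φ(δ_t)`, where `δ_t ∈ X*` is the evaluation
at `t`. -/
def bidual (X : Submodule ℝ V2) : Set V2 :=
  {f | ∃ Φ : StrongDual ℝ (StrongDual ℝ X), ∀ t, f t = Φ ((evalCLM t).comp X.subtypeL)}

/-! ### The measure `μ_f` -/

/-- `μ̃_{f,δ}(S) = sup {v₂²(f, P) : P ⊆ S, ‖P‖_max < δ}`. -/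
def muTildeDelta (f : I → ℝ) (δ : ℝ) (S : Set I) : ℝ :=
  sSup {r | ∃ P : Partition, P.Within S ∧ P.MeshLT δ ∧ r = P.v2sq f}

/-- `μ̃_f(S) = inf_{δ > 0} μ̃_{f,δ}(S)`. -/
def muTilde (f : I → ℝ) (S : Set I) : ℝ :=
  ⨅ δ : {δ : ℝ // 0 < δ}, muTildeDelta f δ S

/-- `F̃_f(x) = 0` for `x ≤ 0` and `F̃_f(x) = μ̃_f([0,x] ∩ [0,1])` for `x > 0`. -/
def distTilde (f : I → ℝ) (x : ℝ) : ℝ :=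
  if x ≤ 0 then 0 else muTilde f {s | (s : ℝ) ≤ x}

lemma muTildeDelta_nonneg (f : I → ℝ) (δ : ℝ) (S : Set I) : 0 ≤ muTildeDelta f δ S := by
  refine Real.sSup_nonneg ?_
  rintro _ ⟨P, -, -, rfl⟩
  exact P.v2sq_nonneg f

lemma muTilde_nonneg (f : I → ℝ) (S : Set I) : 0 ≤ muTilde f S :=
  Real.iInf_nonneg fun _ => muTildeDelta_nonneg f _ S

lemma muTildeDelta_mono (f : V2) (δ : ℝ) {S T : Set I} (h : S ⊆ T) :
    muTildeDelta f δ S ≤ muTildeDelta f δ T := by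
  refine Real.sSup_le ?_ (muTildeDelta_nonneg _ _ _)
  rintro _ ⟨P, hP, hm, rfl⟩
  refine le_csSup ⟨‖f‖ ^ 2, ?_⟩ ⟨P, fun i => h (hP i), hm, rfl⟩
  rintro _ ⟨Q, -, -, rfl⟩
  exact f.v2sq_le Q

lemma muTilde_mono (f : V2) {S T : Set I} (h : S ⊆ T) : muTilde f S ≤ muTilde f T :=
  ciInf_mono ⟨0, by rintro _ ⟨δ, rfl⟩; exact muTildeDelta_nonneg _ _ _⟩
    fun δ => muTildeDelta_mono f δ h

lemma distTilde_mono (f : V2) : Monotone (distTilde f) := by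
  intro x y hxy
  unfold distTilde
  split_ifs with h1 h2 h2
  · exact le_rfl
  · exact muTilde_nonneg _ _
  · exact absurd (hxy.trans h2) h1
  · exact muTilde_mono f fun s hs => le_trans hs hxy

/-- The measure on `ℝ` with the distribution function `F_f(x) = F̃_f(x⁺)`. -/
def muReal (f : V2) : Measure ℝ := (distTilde_mono f).stieltjesFunction.measure

/-- The measure `μ_f` on `[0,1]`. -/
def mu (f : V2) : Measure I := (muReal f).comap Subtype.val

/-- The discrete (atomic) part `μ^d` of a finite measure `μ`. -/
def discretePart (μ : Measure I) : Measure I := μ.restrict {x | μ {x} ≠ 0}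

/-! ### Oscillation, domination, convex block sequences -/

/-- `õsc f(t) = inf {sup_{x ∈ V} |f(x) - f(t)| : V an open neighbourhood of t}`, for a bounded
function `f`. -/
def oscTilde (f : I → ℝ) (t : I) : ℝ :=
  ⨅ V : {V : Set I // IsOpen V ∧ t ∈ V}, ⨆ x : V.1, |f x - f t|

/-- The supremum norm of a bounded function. -/
def supNorm (f : I → ℝ) : ℝ := ⨆ t, |f t|

/-- `G` is `(C, ε)`-dominated by the finite measure `μ`. -/
def IsDominatedBy (G : V2) (C ε : ℝ) (μ : Measure I) : Prop :=
  ∀ F : IntervalFamily, F.v2sq G ≤ C * μ.real F.union + ε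

/-- `h` is a convex block sequence of `u`: each `h n` is a convex combination of the `u i` with
`i` in a finite set `S n`, where `S 0 < S 1 < ⋯`. -/
def IsConvexBlockSeq (u h : ℕ → V2) : Prop :=
  ∃ (S : ℕ → Finset ℕ) (w : ℕ → ℝ),
    (∀ n m, n < m → ∀ i ∈ S n, ∀ j ∈ S m, i < j) ∧
    (∀ i, 0 ≤ w i) ∧ (∀ n, ∑ i ∈ S n, w i = 1) ∧ ∀ n, h n = ∑ i ∈ S n, w i • u i

end QuadVar

end

open QuadVar

namespace QuadVar

/-! ### Finite families of non-overlapping intervals -/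

/-! The core is `exists_convexHull_qv_le`: every tail of `u` has a convex combination `h` whose
values stay close to the local range of `f` (`Near`) and for which `qv (f - h) s` is at most
`μ_f(hull s) + 4‖μ_f^d‖ + ε` for every family `s`, whatever the lengths of its intervals.

Short intervals are handled by `μ_f`. A fine family satisfies `qv f s ≤ μ_f(hull s) + ε`
(`exists_qv_le_mu_hull`), and since `h` is square absolutely continuous, it contributes almost
nothing on intervals that are short enough, depending on `h`. Long intervals are handled by
nearness. Mazur's lemma for continuous functions, applied to the excess of `u n` over continuous
envelopes of `f`, gives convex combinations with values between the local bounds of `f`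
(`exists_convexHull_near`). At separated endpoints the errors are then dominated by increments of
`f` over tiny disjoint intervals, and their squares sum to little more than the mass of the atoms
(`exists_near_qv_le`).

Between the scale on which `h` is near `f` and the scale on which `h` is flat there is no control.
So functions adapted to successively smaller scales are averaged (`qv_sub_average_le`): an interval
is uncontrolled for at most one of the `N` functions, and the total cost of this is of order `1 /
N`.

The blocks are chosen inductively among such `h`. The upper norm bound is convexity, and the lower
one is lower semicontinuity of the norm together with `dist(f, X) > δ`. The supremum bound follows
from nearness at a radius on which `f` oscillates by at most twice its maximal oscillation, and
domination from the core estimate for two blocks (`isDominatedBy_of_qv_le`). For the last claim, `h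
k` is negligible on fine families in `V` that almost exhaust `μ_f(V)`, and pointwise convergence
replaces `f` by a later block. -/

/-- A finite set of pairs `p.1 < p.2`, the endpoints of non-overlapping intervals. -/
def IsFam (s : Finset (I × I)) : Prop :=
  (∀ p ∈ s, p.1 < p.2) ∧ ∀ p ∈ s, ∀ q ∈ s, p ≠ q → p.2 ≤ q.1 ∨ q.2 ≤ p.1

/-- The quadratic variation of `f` along a finite set of pairs. -/
def qv (f : I → ℝ) (s : Finset (I × I)) : ℝ := ∑ p ∈ s, (f p.2 - f p.1) ^ 2

/-- All intervals of the family are shorter than `η`. -/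
def Fine (s : Finset (I × I)) (η : ℝ) : Prop := ∀ p ∈ s, (p.2 : ℝ) - p.1 < η

/-- The union of the closed intervals of the family. -/
def hull (s : Finset (I × I)) : Set I := ⋃ p ∈ s, Icc p.1 p.2

lemma IsFam.subset {s t : Finset (I × I)} (ht : IsFam t) (h : s ⊆ t) : IsFam s :=
  ⟨fun p hp => ht.1 p (h hp), fun p hp q hq => ht.2 p (h hp) q (h hq)⟩

lemma Fine.subset {s t : Finset (I × I)} {η : ℝ} (ht : Fine t η) (h : s ⊆ t) : Fine s η :=
  fun p hp => ht p (h hp)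

lemma Fine.mono {s : Finset (I × I)} {η η' : ℝ} (hs : Fine s η) (h : η ≤ η') : Fine s η' :=
  fun p hp => (hs p hp).trans_le h

lemma hull_mono {s t : Finset (I × I)} (h : s ⊆ t) : hull s ⊆ hull t :=
  biUnion_subset_biUnion_left h

lemma isClosed_hull (s : Finset (I × I)) : IsClosed (hull s) :=
  s.finite_toSet.isClosed_biUnion fun _ _ => isClosed_Icc

lemma qv_nonneg (f : I → ℝ) (s : Finset (I × I)) : 0 ≤ qv f s :=
  Finset.sum_nonneg fun _ _ => sq_nonneg _

lemma qv_mono (f : I → ℝ) {s t : Finset (I × I)} (h : s ⊆ t) : qv f s ≤ qv f t :=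
  Finset.sum_le_sum_of_subset_of_nonneg h fun _ _ _ => sq_nonneg _

lemma fine_two (s : Finset (I × I)) : Fine s 2 := fun p _ => by
  have := p.2.2.2; have := p.1.2.1; linarith

/-- Multiples of `1 / (n + 1) < η` serve; `k / (n + 1)` below is the first one strictly to the right
of `c`. The grid fills the gaps of a family when it is completed to a partition. -/
lemma exists_grid {η : ℝ} (hη : 0 < η) :
    ∃ G : Finset I, ∀ c d : I, η ≤ (d : ℝ) - c → ∃ g ∈ G, c < g ∧ g < d := by
  classical
  obtain ⟨n, hn⟩ := exists_nat_one_div_lt hη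
  have hn0 : (0 : ℝ) < n + 1 := by positivity
  refine ⟨(Finset.range (n + 2)).image fun k => projIcc (0 : ℝ) 1 zero_le_one (k / (n + 1)), ?_⟩
  intro c d hcd
  set k := ⌊(c : ℝ) * (n + 1)⌋₊ + 1 with hk
  have h0 : 0 ≤ (c : ℝ) * (n + 1) := mul_nonneg c.2.1 hn0.le
  have h1 : (c : ℝ) < k / (n + 1) := by
    rw [lt_div_iff₀ hn0, hk]; push_cast; exact Nat.lt_floor_add_one _
  have h2 : (k : ℝ) / (n + 1) < d := by
    have : (k : ℝ) / (n + 1) ≤ c + 1 / (n + 1) := by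
      rw [div_le_iff₀ hn0, hk]; push_cast
      have := Nat.floor_le h0
      field_simp
      linarith
    linarith
  have hk1 : (k : ℝ) / (n + 1) < 1 := h2.trans_le d.2.2
  have hmem : (k : ℝ) / (n + 1) ∈ Icc (0 : ℝ) 1 := ⟨by positivity, hk1.le⟩
  refine ⟨projIcc (0 : ℝ) 1 zero_le_one (k / (n + 1)), Finset.mem_image_of_mem _ ?_, ?_, ?_⟩
  · rw [div_lt_one hn0] at hk1
    have : k < n + 1 := by exact_mod_cast hk1
    simp; omega
  · rw [projIcc_of_mem _ hmem]; exact h1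
  · rw [projIcc_of_mem _ hmem]; exact h2

/-- A family of short intervals in an interval `S` can be completed to a partition of small mesh
in `S`. -/
lemma IsFam.exists_partition {s : Finset (I × I)} (hs : IsFam s) (hne : s.Nonempty) {η : ℝ}
    (hη : Fine s η) {S : Set I} (hS : S.OrdConnected) (hsub : ∀ p ∈ s, p.1 ∈ S ∧ p.2 ∈ S) :
    ∃ P : Partition, P.Within S ∧ P.MeshLT η ∧
      ∀ p ∈ s, ∃ i : Fin P.p, P.t i.castSucc = p.1 ∧ P.t i.succ = p.2 := by
  classical
  obtain ⟨p₀, hp₀⟩ := hne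
  have hη0 : 0 < η := lt_of_le_of_lt (sub_nonneg.2 (hs.1 p₀ hp₀).le) (hη p₀ hp₀)
  obtain ⟨G, hG⟩ := exists_grid hη0
  -- Grid points interior to an interval of `s` are left out, so that each interval of `s` remains a
  -- step of the partition.
  set T : Finset I := (s.image Prod.fst ∪ s.image Prod.snd) ∪
    G.filter (fun g => g ∈ S ∧ ∀ p ∈ s, ¬(p.1 < g ∧ g < p.2)) with hT
  have hTS : ∀ x ∈ T, x ∈ S := by
    intro x hx
    simp only [hT, Finset.mem_union, Finset.mem_image, Finset.mem_filter] at hx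
    rcases hx with (⟨p, hp, rfl⟩ | ⟨p, hp, rfl⟩) | ⟨-, h, -⟩
    · exact (hsub p hp).1
    · exact (hsub p hp).2
    · exact h
  have hT1 : ∀ p ∈ s, p.1 ∈ T := fun p hp => by
    simp only [hT, Finset.mem_union, Finset.mem_image]
    exact Or.inl (Or.inl ⟨p, hp, rfl⟩)
  have hT2 : ∀ p ∈ s, p.2 ∈ T := fun p hp => by
    simp only [hT, Finset.mem_union, Finset.mem_image]
    exact Or.inl (Or.inr ⟨p, hp, rfl⟩)
  have hTint : ∀ x ∈ T, ∀ p ∈ s, ¬(p.1 < x ∧ x < p.2) := by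
    intro x hx p hp ⟨h1, h2⟩
    simp only [hT, Finset.mem_union, Finset.mem_image, Finset.mem_filter] at hx
    rcases hx with (⟨q, hq, rfl⟩ | ⟨q, hq, rfl⟩) | ⟨-, -, h⟩
    · have hpq : p ≠ q := by rintro rfl; exact lt_irrefl _ h1
      rcases hs.2 p hp q hq hpq with h | h
      · exact absurd h2 (not_lt.2 h)
      · exact absurd (h1.trans (hs.1 q hq)) (not_lt.2 h)
    · have hpq : p ≠ q := by rintro rfl; exact lt_irrefl _ h2
      rcases hs.2 p hp q hq hpq with h | h
      · exact absurd ((hs.1 q hq).trans h2) (not_lt.2 h)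
      · exact absurd h1 (not_lt.2 h)
    · exact h p hp ⟨h1, h2⟩
  have hcard : 1 < T.card :=
    Finset.one_lt_card.2 ⟨_, hT1 p₀ hp₀, _, hT2 p₀ hp₀, (hs.1 p₀ hp₀).ne⟩
  obtain ⟨m, hm⟩ : ∃ m, T.card = m + 1 := ⟨T.card - 1, by omega⟩
  set t := T.orderEmbOfFin hm with ht
  have htT : ∀ i, t i ∈ T := fun i => T.orderEmbOfFin_mem hm i
  have htsurj : ∀ x ∈ T, ∃ i, t i = x := fun x hx => by
    have : x ∈ Set.range t := by rw [ht, Finset.range_orderEmbOfFin]; exact hx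
    exact this
  have hcons : ∀ i : Fin m, ∀ x ∈ T, ¬(t i.castSucc < x ∧ x < t i.succ) := by
    rintro i x hx ⟨h1, h2⟩
    obtain ⟨j, rfl⟩ := htsurj x hx
    have h1' := t.lt_iff_lt.1 h1
    have h2' := t.lt_iff_lt.1 h2
    simp only [Fin.lt_def, Fin.val_castSucc, Fin.val_succ] at h1' h2'
    omega
  refine ⟨⟨m, by omega, t, t.strictMono⟩, fun i => hTS _ (htT i), ?_, ?_⟩
  · intro i
    by_contra! hcon
    -- A step of length at least `η` contains a grid point, which can only have been left out
    -- because it is interior to some interval of `s`. That interval then contains the whole step,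
    -- although it is shorter than `η`.
    obtain ⟨g, hgG, hg1, hg2⟩ := hG _ _ hcon
    have hgS : g ∈ S := hS.out (hTS _ (htT i.castSucc)) (hTS _ (htT i.succ)) ⟨hg1.le, hg2.le⟩
    have hgT : g ∉ T := fun h => hcons i g h ⟨hg1, hg2⟩
    have : ∃ p ∈ s, p.1 < g ∧ g < p.2 := by
      by_contra! h'
      apply hgT
      simp only [hT, Finset.mem_union, Finset.mem_filter]
      exact Or.inr ⟨hgG, hgS, fun p hp ⟨h1, h2⟩ => absurd h2 (not_lt.2 (h' p hp h1))⟩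
    obtain ⟨p, hp, h1, h2⟩ := this
    have e1 : p.1 ≤ t i.castSucc := by
      by_contra! h'
      exact hcons i _ (hT1 p hp) ⟨h', h1.trans hg2⟩
    have e2 : t i.succ ≤ p.2 := by
      by_contra! h'
      exact hcons i _ (hT2 p hp) ⟨hg1.trans h2, h'⟩
    have e3 := hη p hp
    have e1' : (p.1 : ℝ) ≤ t i.castSucc := e1
    have e2' : (t i.succ : ℝ) ≤ p.2 := e2
    simp only at hcon
    linarith
  · intro p hp
    obtain ⟨i, hi⟩ := htsurj _ (hT1 p hp)
    obtain ⟨j, hj⟩ := htsurj _ (hT2 p hp)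
    have hij : i < j := t.lt_iff_lt.1 (by rw [hi, hj]; exact hs.1 p hp)
    have him : (i : ℕ) < m := by have := j.2; simp only [Fin.lt_def] at hij; omega
    refine ⟨⟨i, him⟩, hi, ?_⟩
    have hle : (⟨i, him⟩ : Fin m).succ ≤ j := by
      simp only [Fin.le_def, Fin.val_succ, Fin.lt_def] at *; omega
    rcases hle.lt_or_eq with h | h
    · refine absurd ?_ (hTint _ (htT (⟨i, him⟩ : Fin m).succ) p hp)
      constructor
      · rw [← hi]; apply t.strictMono; simp [Fin.lt_def]
      · rw [← hj]; exact t.strictMono h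
    · simp only at *
      rw [h, hj]

/-- Stated for a general `φ` because it is needed both for squared increments and for lengths. -/
lemma Partition.sum_le_sum {s : Finset (I × I)} {P : Partition}
    (h : ∀ p ∈ s, ∃ i : Fin P.p, P.t i.castSucc = p.1 ∧ P.t i.succ = p.2)
    (φ : I → I → ℝ) (hφ : ∀ x y, x ≤ y → 0 ≤ φ x y) :
    ∑ p ∈ s, φ p.1 p.2 ≤ ∑ i : Fin P.p, φ (P.t i.castSucc) (P.t i.succ) := by
  classical
  have hinj : Function.Injective fun i : Fin P.p => (P.t i.castSucc, P.t i.succ) := by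
    intro i j hij
    exact Fin.castSucc_injective _ (P.strictMono.injective (Prod.ext_iff.1 hij).1)
  have e : ∑ i : Fin P.p, φ (P.t i.castSucc) (P.t i.succ) =
      ∑ p ∈ Finset.univ.image (fun i : Fin P.p => (P.t i.castSucc, P.t i.succ)), φ p.1 p.2 := by
    rw [Finset.sum_image fun i _ j _ h => hinj h]
  rw [e]
  refine Finset.sum_le_sum_of_subset_of_nonneg ?_ ?_
  · intro p hp
    obtain ⟨i, h1, h2⟩ := h p hp
    exact Finset.mem_image.2 ⟨i, Finset.mem_univ _, Prod.ext h1 h2⟩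
  · intro p hp _
    obtain ⟨i, -, rfl⟩ := Finset.mem_image.1 hp
    exact hφ _ _ (P.strictMono i.castSucc_lt_succ).le

lemma IsFam.exists_partition_qv_le {s : Finset (I × I)} (hs : IsFam s) (hne : s.Nonempty) {η : ℝ}
    (hη : Fine s η) {S : Set I} (hS : S.OrdConnected) (hsub : ∀ p ∈ s, p.1 ∈ S ∧ p.2 ∈ S)
    (f : I → ℝ) : ∃ P : Partition, P.Within S ∧ P.MeshLT η ∧ qv f s ≤ P.v2sq f := by
  obtain ⟨P, h1, h2, h3⟩ := hs.exists_partition hne hη hS hsub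
  exact ⟨P, h1, h2, Partition.sum_le_sum h3 (fun x y => (f y - f x) ^ 2) fun _ _ _ => sq_nonneg _⟩

/-- The intervals of a partition. -/
noncomputable def Partition.fam (P : Partition) : Finset (I × I) :=
  Finset.univ.image fun i : Fin P.p => (P.t i.castSucc, P.t i.succ)

lemma Partition.mem_fam {P : Partition} {p : I × I} :
    p ∈ P.fam ↔ ∃ i : Fin P.p, (P.t i.castSucc, P.t i.succ) = p := by
  simp [Partition.fam]

lemma Partition.isFam (P : Partition) : IsFam P.fam := by
  constructor
  · intro p hp
    obtain ⟨i, rfl⟩ := Partition.mem_fam.1 hp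
    exact P.strictMono i.castSucc_lt_succ
  · intro p hp q hq hpq
    obtain ⟨i, rfl⟩ := Partition.mem_fam.1 hp
    obtain ⟨j, rfl⟩ := Partition.mem_fam.1 hq
    rcases lt_trichotomy i j with h | rfl | h
    · exact Or.inl (P.strictMono.monotone (by
        simp only [Fin.le_def, Fin.lt_def, Fin.val_succ, Fin.val_castSucc] at *; omega))
    · exact absurd rfl hpq
    · exact Or.inr (P.strictMono.monotone (by
        simp only [Fin.le_def, Fin.lt_def, Fin.val_succ, Fin.val_castSucc] at *; omega))

lemma Partition.qv_fam (P : Partition) (f : I → ℝ) : qv f P.fam = P.v2sq f := by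
  rw [qv, Partition.fam, Finset.sum_image]
  · rfl
  · intro i _ j _ hij
    exact Fin.castSucc_injective _ (P.strictMono.injective (Prod.ext_iff.1 hij).1)

lemma IsFam.qv_le {s : Finset (I × I)} (hs : IsFam s) (f : V2) : qv f s ≤ ‖f‖ ^ 2 := by
  rcases s.eq_empty_or_nonempty with rfl | hne
  · simp only [qv, Finset.sum_empty]; positivity
  obtain ⟨P, -, -, h⟩ := hs.exists_partition_qv_le hne (fine_two s) ordConnected_univ
    (fun _ _ => ⟨mem_univ _, mem_univ _⟩) f
  exact h.trans (f.v2sq_le P)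

lemma IsFam.sum_length_le {s : Finset (I × I)} (hs : IsFam s) :
    ∑ p ∈ s, ((p.2 : ℝ) - p.1) ≤ 1 := by
  rcases s.eq_empty_or_nonempty with rfl | hne
  · simp
  obtain ⟨P, -, -, h⟩ := hs.exists_partition hne (fine_two s) ordConnected_univ
    fun _ _ => ⟨mem_univ _, mem_univ _⟩
  refine (Partition.sum_le_sum h (fun x y => (y : ℝ) - x) fun x y hxy => sub_nonneg.2 hxy).trans ?_
  have e : ∑ i : Fin P.p, ((P.t i.succ : ℝ) - P.t i.castSucc) = P.t (Fin.last _) - P.t 0 := by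
    have h1 := Fin.sum_univ_succ fun i => (P.t i : ℝ)
    have h2 := Fin.sum_univ_castSucc fun i => (P.t i : ℝ)
    rw [Finset.sum_sub_distrib]; linarith
  rw [e]
  have := (P.t (Fin.last _)).2.2
  have := (P.t 0).2.1
  linarith

/-- This bound on the number of long intervals allows an error proportional to `η` on each of them.
-/
lemma IsFam.card_mul_le {s : Finset (I × I)} (hs : IsFam s) {η : ℝ}
    (h : ∀ p ∈ s, η ≤ (p.2 : ℝ) - p.1) : s.card * η ≤ 1 := by
  refine le_trans ?_ hs.sum_length_le
  rw [← nsmul_eq_mul]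
  exact Finset.card_nsmul_le_sum _ _ _ h

/-- A family as an `IntervalFamily` of closed intervals. -/
lemma IsFam.exists_intervalFamily {s : Finset (I × I)} (hs : IsFam s) :
    ∃ F : IntervalFamily, (∀ f, F.v2sq f = qv f s) ∧ F.union = hull s := by
  classical
  let e := s.equivFin.symm
  refine ⟨⟨s.card, fun i => (e i).1.1, fun i => (e i).1.2, fun i => Icc (e i).1.1 (e i).1.2,
    fun i => (hs.1 _ (e i).2).le, fun i => Ioo_subset_Icc_self, fun i => Subset.rfl, ?_⟩, ?_, ?_⟩
  · intro i j hij
    have hne : (e i).1 ≠ (e j).1 := fun h => hij (e.injective (Subtype.ext h))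
    rw [Set.disjoint_left]
    rintro x ⟨h1, h2⟩ ⟨h3, h4⟩
    rcases hs.2 _ (e i).2 _ (e j).2 hne with h | h
    · exact absurd (h2.trans_le h) (not_lt.2 h3.le)
    · exact absurd (h4.trans_le h) (not_lt.2 h1.le)
  · intro f
    simp only [IntervalFamily.v2sq, qv]
    rw [← Finset.sum_coe_sort s fun p => (f p.2 - f p.1) ^ 2]
    exact e.sum_comp fun p : s => (f p.1.2 - f p.1.1) ^ 2
  · ext x
    simp only [IntervalFamily.union, hull, mem_iUnion]
    constructor
    · rintro ⟨i, hi⟩; exact ⟨_, (e i).2, hi⟩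
    · rintro ⟨p, hp, hx⟩
      refine ⟨e.symm ⟨p, hp⟩, ?_⟩
      simpa using hx

/-- The non-degenerate intervals of an `IntervalFamily`. -/
lemma IntervalFamily.exists_isFam (F : IntervalFamily) :
    ∃ s, IsFam s ∧ (∀ f, qv f s = F.v2sq f) ∧
      ∃ E : Set I, E.Finite ∧ hull s ⊆ F.union ∪ E := by
  classical
  set T := Finset.univ.filter fun i => F.left i < F.right i with hT
  have hdis : ∀ i ∈ T, ∀ j ∈ T, i ≠ j → F.right i ≤ F.left j ∨ F.right j ≤ F.left i := by
    intro i hi j hj hij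
    simp only [hT, Finset.mem_filter, Finset.mem_univ, true_and] at hi hj
    by_contra! h
    obtain ⟨x, hx1, hx2⟩ := exists_between
      (max_lt (lt_min hi h.2) (lt_min h.1 hj) :
        max (F.left i) (F.left j) < min (F.right i) (F.right j))
    rw [max_lt_iff] at hx1
    rw [lt_min_iff] at hx2
    exact Set.disjoint_left.1 (F.disjoint i j hij) ⟨hx1.1, hx2.1⟩ ⟨hx1.2, hx2.2⟩
  have hinj : ∀ i ∈ T, ∀ j ∈ T, (F.left i, F.right i) = (F.left j, F.right j) → i = j := by
    intro i hi j hj h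
    by_contra hij
    have h1 := hdis i hi j hj hij
    simp only [hT, Finset.mem_filter, Finset.mem_univ, true_and] at hi
    rw [Prod.mk.injEq] at h
    rw [← h.1, ← h.2, or_self] at h1
    exact absurd hi (not_lt.2 h1)
  -- The exceptional set consists of all endpoints, since the carriers need not contain them.
  refine ⟨T.image fun i => (F.left i, F.right i), ⟨?_, ?_⟩, ?_,
    range F.left ∪ range F.right, (finite_range _).union (finite_range _), ?_⟩
  · intro p hp
    obtain ⟨i, hi, rfl⟩ := Finset.mem_image.1 hp
    simpa [hT] using hi
  · intro p hp q hq hpq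
    obtain ⟨i, hi, rfl⟩ := Finset.mem_image.1 hp
    obtain ⟨j, hj, rfl⟩ := Finset.mem_image.1 hq
    exact hdis i hi j hj fun h => hpq (by rw [h])
  · intro f
    rw [qv, Finset.sum_image hinj, IntervalFamily.v2sq, hT, Finset.sum_filter]
    refine Finset.sum_congr rfl fun i _ => ?_
    split_ifs with h
    · rfl
    · rw [le_antisymm (F.left_le_right i) (not_lt.1 h)]; simp
  · intro x hx
    simp only [hull, mem_iUnion] at hx
    obtain ⟨p, hp, hx⟩ := hx
    obtain ⟨i, hi, rfl⟩ := Finset.mem_image.1 hp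
    rcases hx.1.eq_or_lt with h | h
    · exact Or.inr (Or.inl ⟨i, h⟩)
    rcases hx.2.eq_or_lt with h' | h'
    · exact Or.inr (Or.inr ⟨i, h'.symm⟩)
    exact Or.inl (mem_iUnion.2 ⟨i, F.Ioo_subset i ⟨h, h'⟩⟩)

/-- The lengths sum to at most `1`, so the squared lengths sum to at most the bound on the single
lengths. -/
lemma SquareAbsCont.exists_fine {g : I → ℝ} (hg : SquareAbsCont g) {ε : ℝ} (hε : 0 < ε) :
    ∃ η > 0, ∀ s, IsFam s → Fine s η → qv g s < ε := by
  obtain ⟨η, hη, h⟩ := hg ε hε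
  refine ⟨η / 2, by positivity, fun s hs hf => ?_⟩
  obtain ⟨F, hF, -⟩ := hs.exists_intervalFamily
  rw [← hF]
  apply h
  rw [hF]
  calc qv (fun t => (t : ℝ)) s ≤ ∑ p ∈ s, (η / 2) * ((p.2 : ℝ) - p.1) := by
        refine Finset.sum_le_sum fun p hp => ?_
        have h1 := hf p hp
        have h2 : (p.1 : ℝ) < p.2 := hs.1 p hp
        rw [sq]
        exact mul_le_mul_of_nonneg_right h1.le (by linarith)
    _ ≤ η / 2 * 1 := by
        rw [← Finset.mul_sum]
        exact mul_le_mul_of_nonneg_left hs.sum_length_le (by positivity)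
    _ < η := by linarith

lemma SquareAbsCont.continuous {g : I → ℝ} (hg : SquareAbsCont g) : Continuous g := by
  rw [Metric.continuous_iff]
  intro x ε hε
  obtain ⟨η, hη, h⟩ := hg.exists_fine (show 0 < ε ^ 2 by positivity)
  refine ⟨η, hη, fun y hy => ?_⟩
  have key : ∀ a b : I, a < b → dist a b < η → dist (g b) (g a) < ε := by
    intro a b hab hd
    have h1 := h {(a, b)} ⟨by simpa using hab, by
      intro p hp q hq hpq
      simp only [Finset.mem_singleton] at hp hq
      exact absurd (hp.trans hq.symm) hpq⟩ (by
        intro p hp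
        simp only [Finset.mem_singleton] at hp
        subst hp
        rw [dist_comm, Subtype.dist_eq, Real.dist_eq] at hd
        exact (le_abs_self _).trans_lt hd)
    simp only [qv, Finset.sum_singleton] at h1
    rw [Real.dist_eq]
    exact abs_lt_of_sq_lt_sq h1 hε.le
  rcases lt_trichotomy x y with hxy | rfl | hxy
  · exact key _ _ hxy (by rwa [dist_comm])
  · simpa using hε
  · rw [dist_comm]; exact key _ _ hxy hy

/-! ### The measure `μ_f` and families of intervals -/

lemma distTilde_nonneg (f : V2) (x : ℝ) : 0 ≤ distTilde f x := by
  unfold distTilde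
  split_ifs
  · exact le_rfl
  · exact muTilde_nonneg _ _

lemma bddAbove_v2sq (f : V2) (δ : ℝ) (S : Set I) :
    BddAbove {r | ∃ P : Partition, P.Within S ∧ P.MeshLT δ ∧ r = P.v2sq f} := by
  refine ⟨‖f‖ ^ 2, ?_⟩
  rintro _ ⟨Q, -, -, rfl⟩
  exact f.v2sq_le Q

/-- A fine family in `[0, x]` extends to a partition in `[0, x]` with the same mesh bound, and the
added steps only increase the quadratic variation. -/
lemma exists_qv_le_distTilde (f : V2) (x : ℝ) {ε : ℝ} (hε : 0 < ε) :
    ∃ η > 0, ∀ s, IsFam s → Fine s η → (∀ p ∈ s, (p.2 : ℝ) ≤ x) →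
      qv f s ≤ distTilde f x + ε := by
  by_cases hx : x ≤ 0
  · refine ⟨1, one_pos, fun s hs _ hsx => ?_⟩
    rcases s.eq_empty_or_nonempty with rfl | ⟨p, hp⟩
    · simp only [qv, Finset.sum_empty]
      have := distTilde_nonneg f x; linarith
    · have h1 : (p.1 : ℝ) < p.2 := hs.1 p hp
      have h2 := p.1.2.1
      have h3 := hsx p hp
      linarith
  · have h : muTilde f {s | (s : ℝ) ≤ x} < distTilde f x + ε := by
      rw [distTilde, if_neg hx]; linarith
    obtain ⟨⟨η, hη⟩, hlt⟩ := exists_lt_of_ciInf_lt h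
    refine ⟨η, hη, fun s hs hf hsx => ?_⟩
    rcases s.eq_empty_or_nonempty with rfl | hne
    · simp only [qv, Finset.sum_empty]
      have := distTilde_nonneg f x; linarith
    obtain ⟨P, h1, h2, h3⟩ := hs.exists_partition_qv_le hne hf (S := {s : I | (s : ℝ) ≤ x})
      ⟨fun a _ b hb c hc => le_trans (show (c : ℝ) ≤ b from hc.2) hb⟩
      (fun p hp => ⟨le_trans (show (p.1 : ℝ) ≤ p.2 from (hs.1 p hp).le) (hsx p hp), hsx p hp⟩) f
    exact h3.trans ((le_csSup (bddAbove_v2sq f η _) ⟨P, h1, h2, rfl⟩).trans hlt.le)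

lemma exists_distTilde_lt_qv (f : V2) (x : ℝ) {ε η : ℝ} (hε : 0 < ε) (hη : 0 < η) :
    ∃ s, IsFam s ∧ Fine s η ∧ (∀ p ∈ s, (p.2 : ℝ) ≤ x) ∧ distTilde f x - ε < qv f s := by
  have hempty : distTilde f x < ε → ∃ s, IsFam s ∧ Fine s η ∧ (∀ p ∈ s, (p.2 : ℝ) ≤ x) ∧
      distTilde f x - ε < qv f s := fun h =>
    ⟨∅, ⟨by simp, by simp⟩, by simp [Fine], by simp, by simpa [qv] using h⟩
  by_cases hx : x ≤ 0
  · exact hempty (by rw [distTilde, if_pos hx]; exact hε)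
  have h1 : muTilde f {s | (s : ℝ) ≤ x} ≤ muTildeDelta f η {s | (s : ℝ) ≤ x} :=
    ciInf_le ⟨0, by rintro _ ⟨δ, rfl⟩; exact muTildeDelta_nonneg _ _ _⟩
      (⟨η, hη⟩ : {δ : ℝ // 0 < δ})
  -- If there were no admissible partition, the supremum would take its default value `0`, and the
  -- empty family would do.
  rcases Set.eq_empty_or_nonempty
    {r | ∃ P : Partition, P.Within {s : I | (s : ℝ) ≤ x} ∧ P.MeshLT η ∧ r = P.v2sq f} with h | h
  · apply hempty
    rw [muTildeDelta, h, Real.sSup_empty] at h1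
    rw [distTilde, if_neg hx]; linarith
  · have h2 : distTilde f x - ε < muTildeDelta f η {s | (s : ℝ) ≤ x} := by
      rw [distTilde, if_neg hx]; linarith
    obtain ⟨_, ⟨P, hP1, hP2, rfl⟩, hlt⟩ := exists_lt_of_lt_csSup h h2
    refine ⟨P.fam, P.isFam, ?_, ?_, by rwa [P.qv_fam]⟩
    · intro p hp
      obtain ⟨i, rfl⟩ := Partition.mem_fam.1 hp
      exact hP2 i
    · intro p hp
      obtain ⟨i, rfl⟩ := Partition.mem_fam.1 hp
      exact hP1 _

/-- The part of a fine family to the right of one of the points `c₁ < ⋯ < c_k` of an interval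
`(a, c]` carries almost all of the variation that is not carried by `[0, c]`. -/
lemma exists_fam_Ioo_of_distTilde (f : V2) {a c d θ η : ℝ} (hac : a < c)
    (hθ : distTilde f c + θ < distTilde f d) (hη : 0 < η) :
    ∃ s, IsFam s ∧ Fine s η ∧ (∀ p ∈ s, a < p.1 ∧ (p.2 : ℝ) ≤ d) ∧ θ < qv f s := by
  classical
  -- Three losses of at most `κ`: in the choice of `s`, in the part left of the cut, and in the
  -- intervals that straddle the cut.
  set κ := (distTilde f d - distTilde f c - θ) / 3 with hκ
  have hκ0 : 0 < κ := by rw [hκ]; linarith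
  obtain ⟨k, hk⟩ := exists_nat_gt (‖f‖ ^ 2 / κ)
  have hk0 : (0 : ℝ) < k := lt_of_le_of_lt (by positivity) hk
  have hkn : 0 < k := by exact_mod_cast hk0
  set w := (c - a) / k with hw
  have hw0 : 0 < w := div_pos (sub_pos.2 hac) hk0
  obtain ⟨η₀, hη₀, hle⟩ := exists_qv_le_distTilde f c hκ0
  obtain ⟨s, hs, hfine, hsd, hlt⟩ :=
    exists_distTilde_lt_qv f d hκ0 (lt_min (lt_min hη hη₀) hw0)
  set x : ℕ → ℝ := fun j => a + (j + 1) * w with hx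
  set M : ℕ → Finset (I × I) := fun j => s.filter fun p => (p.1 : ℝ) ≤ x j ∧ x j < p.2 with hM
  -- The intervals are shorter than the spacing `w`, so each straddles at most one of the points `x
  -- j`.
  have hdisj : ((Finset.range k : Finset ℕ) : Set ℕ).PairwiseDisjoint M := by
    have key : ∀ i j, i < j → Disjoint (M i) (M j) := by
      intro i j hij
      rw [Finset.disjoint_left]
      intro p hp hq
      simp only [hM, Finset.mem_filter] at hp hq
      have h1 := hfine p hp.1
      have h2 : (p.2 : ℝ) - p.1 < w := h1.trans_le (min_le_right _ _)
      have h3 : x i + w ≤ x j := by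
        simp only [hx]
        have : (i : ℝ) + 1 ≤ j := by exact_mod_cast hij
        nlinarith
      linarith [hp.2.1, hq.2.2]
    intro i _ j _ hij
    rcases lt_or_gt_of_ne hij with h | h
    · exact key i j h
    · exact (key j i h).symm
  have hsum : ∑ j ∈ Finset.range k, qv f (M j) ≤ ‖f‖ ^ 2 := by
    have : ∑ j ∈ Finset.range k, qv f (M j) = qv f ((Finset.range k).biUnion M) := by
      rw [qv, Finset.sum_biUnion hdisj]; rfl
    rw [this]
    exact (hs.subset (Finset.biUnion_subset.2 fun j _ => Finset.filter_subset _ _)).qv_le f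
  -- Pigeonhole: `k * κ` exceeds `‖f‖ ^ 2`, so one cut point is straddled by little variation.
  obtain ⟨j, hj, hjle⟩ : ∃ j ∈ Finset.range k, qv f (M j) < κ := by
    by_contra! h
    have := Finset.card_nsmul_le_sum (Finset.range k) (fun j => qv f (M j)) κ h
    rw [Finset.card_range, nsmul_eq_mul] at this
    rw [div_lt_iff₀ hκ0] at hk
    linarith
  have hjk : (j : ℝ) + 1 ≤ k := by exact_mod_cast Finset.mem_range.1 hj
  have hxc : x j ≤ c := by
    have : (k : ℝ) * w = c - a := by rw [hw]; field_simp
    simp only [hx]; nlinarith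
  have hax : a < x j := by simp only [hx]; have : (0 : ℝ) < (j + 1) * w := by positivity
                           linarith
  set A := s.filter fun p => (p.2 : ℝ) ≤ x j with hA
  set B := s.filter fun p => x j < (p.1 : ℝ) with hB
  have hsub : s ⊆ (A ∪ M j) ∪ B := by
    intro p hp
    simp only [hA, hB, hM, Finset.mem_union, Finset.mem_filter, hp, true_and]
    rcases le_or_gt (p.2 : ℝ) (x j) with h | h
    · exact Or.inl (Or.inl h)
    · rcases le_or_gt (p.1 : ℝ) (x j) with h' | h'
      · exact Or.inl (Or.inr ⟨h', h⟩)
      · exact Or.inr h'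
  have hqs : qv f s ≤ qv f A + qv f (M j) + qv f B := by
    refine (qv_mono f hsub).trans ?_
    have hu : ∀ s t : Finset (I × I), qv f (s ∪ t) ≤ qv f s + qv f t := by
      intro s t
      have h1 : ∑ p ∈ s ∪ t, (f p.2 - f p.1) ^ 2 + ∑ p ∈ s ∩ t, (f p.2 - f p.1) ^ 2 = _ :=
        Finset.sum_union_inter
      have h2 : 0 ≤ ∑ p ∈ s ∩ t, (f p.2 - f p.1) ^ 2 := qv_nonneg f (s ∩ t)
      simp only [qv]; linarith
    linarith [hu (A ∪ M j) B, hu A (M j)]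
  have hqA : qv f A ≤ distTilde f c + κ := by
    refine hle A (hs.subset (Finset.filter_subset _ _)) ?_ ?_
    · exact (hfine.subset (Finset.filter_subset _ _)).mono
        ((min_le_left _ _).trans (min_le_right _ _))
    · intro p hp
      exact (Finset.mem_filter.1 hp).2.trans hxc
  refine ⟨B, hs.subset (Finset.filter_subset _ _), ?_, ?_, ?_⟩
  · exact (hfine.subset (Finset.filter_subset _ _)).mono ((min_le_left _ _).trans (min_le_left _ _))
  · intro p hp
    exact ⟨hax.trans (Finset.mem_filter.1 hp).2, hsd p (Finset.mem_filter.1 hp).1⟩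
  · linarith

/-- The mass of `(a, b)` is a left limit at `b` minus a right limit at `a`, so it is nearly an
increment of `distTilde f` between points `c > a` and `d < b`. This is what keeps the family
strictly inside the interval. -/
lemma exists_fam_Ioo (f : V2) {a b θ η : ℝ} (hθ : θ < (muReal f).real (Ioo a b)) (hη : 0 < η) :
    ∃ s, IsFam s ∧ Fine s η ∧ (∀ p ∈ s, a < p.1 ∧ (p.2 : ℝ) < b) ∧ θ < qv f s := by
  by_cases hθ0 : θ < 0
  · exact ⟨∅, ⟨by simp, by simp⟩, by simp [Fine], by simp, by simpa [qv] using hθ0⟩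
  push Not at hθ0
  have hab : a < b := by
    by_contra! h
    rw [Ioo_eq_empty (not_lt.2 h), measureReal_empty] at hθ
    linarith
  set F := (distTilde_mono f).stieltjesFunction with hF
  have h1 : θ < Function.leftLim F b - F a := by
    rw [Measure.real, muReal, StieltjesFunction.measure_Ioo] at hθ
    by_contra! h
    have := ENNReal.toReal_mono (ENNReal.ofReal_ne_top) (ENNReal.ofReal_le_ofReal h)
    rw [ENNReal.toReal_ofReal hθ0] at this
    linarith
  have h2 : ∀ᶠ x in 𝓝[<] b, F a + θ < F x :=
    (F.mono.tendsto_leftLim b).eventually (lt_mem_nhds (by linarith))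
  obtain ⟨x, hx, hxab⟩ := (h2.and (Ioo_mem_nhdsLT hab)).exists
  obtain ⟨d, hxd, hdb⟩ := exists_between hxab.2
  have hFx : F x ≤ distTilde f d := by
    rw [hF, (distTilde_mono f).stieltjesFunction_eq]
    exact (distTilde_mono f).rightLim_le hxd
  have h3 : ∀ᶠ y in 𝓝[>] a, distTilde f y < distTilde f d - θ := by
    refine ((distTilde_mono f).tendsto_rightLim a).eventually (gt_mem_nhds ?_)
    rw [← (distTilde_mono f).stieltjesFunction_eq]
    linarith
  obtain ⟨c, hc, hca⟩ := (h3.and self_mem_nhdsWithin).exists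
  obtain ⟨s, h4, h5, h6, h7⟩ := exists_fam_Ioo_of_distTilde f (a := a) (c := c) (d := d) (θ := θ)
    hca (by linarith) hη
  exact ⟨s, h4, h5, fun p hp => ⟨(h6 p hp).1, (h6 p hp).2.trans_lt hdb⟩, h7⟩

lemma muReal_Icc (f : V2) : (muReal f).real (Icc 0 1) = muTilde f univ := by
  set F := (distTilde_mono f).stieltjesFunction with hF
  have hl : Function.leftLim F 0 = 0 := by
    apply leftLim_eq_of_tendsto
    refine tendsto_const_nhds.congr' ?_
    filter_upwards [self_mem_nhdsWithin] with x hx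
    rw [hF, (distTilde_mono f).stieltjesFunction_eq]
    refine (rightLim_eq_of_tendsto ?_).symm
    refine tendsto_const_nhds.congr' ?_
    filter_upwards [mem_nhdsWithin_of_mem_nhds (Iio_mem_nhds hx)] with y hy
    rw [distTilde, if_pos (le_of_lt hy)]
  have hu : ∀ y : ℝ, 1 ≤ y → {s : I | (s : ℝ) ≤ y} = univ := fun y hy =>
    eq_univ_of_forall fun s => s.2.2.trans hy
  have hr : F 1 = muTilde f univ := by
    rw [hF, (distTilde_mono f).stieltjesFunction_eq]
    apply rightLim_eq_of_tendsto
    refine tendsto_const_nhds.congr' ?_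
    filter_upwards [self_mem_nhdsWithin] with y hy
    have hy' : (1 : ℝ) < y := hy
    rw [distTilde, if_neg (by linarith), hu y hy'.le]
  rw [Measure.real, muReal, StieltjesFunction.measure_Icc, hl, hr, sub_zero,
    ENNReal.toReal_ofReal (muTilde_nonneg _ _)]

lemma mu_apply (f : V2) (S : Set I) : mu f S = muReal f (Subtype.val '' S) :=
  (MeasurableEmbedding.subtype_coe measurableSet_Icc).comap_apply _ _

lemma mu_univ (f : V2) : (mu f).real univ = muTilde f univ := by
  rw [Measure.real, mu_apply, image_univ, Subtype.range_coe, ← muReal_Icc]; rfl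

instance (f : V2) : IsFiniteMeasure (mu f) := by
  constructor
  rw [mu_apply, image_univ, Subtype.range_coe, muReal, StieltjesFunction.measure_Icc]
  exact ENNReal.ofReal_lt_top

lemma muTilde_univ_le (f : V2) : muTilde f univ ≤ ‖f‖ ^ 2 := by
  refine (ciInf_le ⟨0, by rintro _ ⟨δ, rfl⟩; exact muTildeDelta_nonneg _ _ _⟩
      (⟨1, one_pos⟩ : {δ : ℝ // 0 < δ})).trans ?_
  refine Real.sSup_le ?_ (by positivity)
  rintro _ ⟨P, -, -, rfl⟩
  exact f.v2sq_le P

/-! ### Gluing families, approximation of `μ_f` from below on open sets -/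

lemma le_or_le_of_disjoint_Icc {a b c d : I} (hab : a ≤ b) (hcd : c ≤ d)
    (h : Disjoint (Icc a b) (Icc c d)) : b ≤ c ∨ d ≤ a := by
  by_contra! hcon
  exact Set.disjoint_left.1 h (show max a c ∈ Icc a b from ⟨le_max_left _ _, max_le hab hcon.1.le⟩)
    ⟨le_max_right _ _, max_le hcon.2.le hcd⟩

lemma Icc_subset_hull {s : Finset (I × I)} {p : I × I} (hp : p ∈ s) : Icc p.1 p.2 ⊆ hull s :=
  subset_biUnion_of_mem (u := fun p : I × I => Icc p.1 p.2) hp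

lemma hull_biUnion [DecidableEq (I × I)] {ι : Type*} (t : Finset ι) (s : ι → Finset (I × I)) :
    hull (t.biUnion s) = ⋃ i ∈ t, hull (s i) := by
  ext x
  simp only [hull, mem_iUnion, Finset.mem_biUnion, exists_prop]
  constructor
  · rintro ⟨p, ⟨i, hi, hp⟩, hx⟩; exact ⟨i, hi, p, hp, hx⟩
  · rintro ⟨i, hi, p, hp, hx⟩; exact ⟨p, ⟨i, hi, hp⟩, hx⟩

lemma IsFam.biUnion [DecidableEq (I × I)] {ι : Type*} {t : Finset ι} {s : ι → Finset (I × I)}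
    (hs : ∀ i ∈ t, IsFam (s i))
    (hd : ∀ i ∈ t, ∀ j ∈ t, i ≠ j → Disjoint (hull (s i)) (hull (s j))) :
    IsFam (t.biUnion s) ∧ ∀ f, qv f (t.biUnion s) = ∑ i ∈ t, qv f (s i) := by
  refine ⟨⟨?_, ?_⟩, fun f => ?_⟩
  · intro p hp
    obtain ⟨i, hi, hp⟩ := Finset.mem_biUnion.1 hp
    exact (hs i hi).1 p hp
  · intro p hp q hq hpq
    obtain ⟨i, hi, hp⟩ := Finset.mem_biUnion.1 hp
    obtain ⟨j, hj, hq⟩ := Finset.mem_biUnion.1 hq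
    by_cases hij : i = j
    · subst hij; exact (hs i hi).2 p hp q hq hpq
    · exact le_or_le_of_disjoint_Icc ((hs i hi).1 p hp).le ((hs j hj).1 q hq).le
        ((hd i hi j hj hij).mono (Icc_subset_hull hp) (Icc_subset_hull hq))
  · rw [qv, Finset.sum_biUnion]; · rfl
    intro i hi j hj hij
    refine Finset.disjoint_left.2 fun p hp hq => ?_
    exact Set.disjoint_left.1 (hd i hi j hj hij)
      (Icc_subset_hull hp (left_mem_Icc.2 ((hs i hi).1 p hp).le))
      (Icc_subset_hull hq (left_mem_Icc.2 ((hs i hi).1 p hp).le))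

/-- A bounded open subset of the line is a countable disjoint union of open intervals. -/
lemma exists_countable_Ioo {V : Set ℝ} (hV : IsOpen V) (hb : BddBelow V) (ha : BddAbove V) :
    ∃ 𝒞 : Set (Set ℝ), 𝒞.Countable ∧ 𝒞.Pairwise Disjoint ∧ ⋃₀ 𝒞 = V ∧
      ∀ C ∈ 𝒞, ∃ a b, C = Ioo a b := by
  have hopen : ∀ x, IsOpen (connectedComponentIn V x) := fun x => hV.connectedComponentIn
  have hpair : (connectedComponentIn V '' V).Pairwise Disjoint := by
    rintro _ ⟨x, hx, rfl⟩ _ ⟨y, hy, rfl⟩ hne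
    rw [Set.disjoint_left]
    intro z hz hz'
    exact hne ((connectedComponentIn_eq hz).trans (connectedComponentIn_eq hz').symm)
  refine ⟨connectedComponentIn V '' V, ?_, hpair, ?_, ?_⟩
  · refine Set.PairwiseDisjoint.countable_of_isOpen (s := id) hpair ?_ ?_
    · rintro _ ⟨x, hx, rfl⟩; exact hopen x
    · rintro _ ⟨x, hx, rfl⟩; exact ⟨x, mem_connectedComponentIn hx⟩
  · apply Subset.antisymm
    · apply sUnion_subset
      rintro _ ⟨x, hx, rfl⟩
      exact connectedComponentIn_subset V x
    · intro x hx
      exact mem_sUnion.2 ⟨_, ⟨x, hx, rfl⟩, mem_connectedComponentIn hx⟩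
  · rintro _ ⟨x, hx, rfl⟩
    have hc : IsConnected (connectedComponentIn V x) := isConnected_connectedComponentIn_iff.2 hx
    have hb' := hb.mono (connectedComponentIn_subset V x)
    have ha' := ha.mono (connectedComponentIn_subset V x)
    refine ⟨_, _, Subset.antisymm ?_ (hc.Ioo_csInf_csSup_subset hb' ha')⟩
    rw [← interior_Icc]
    exact interior_maximal (subset_Icc_csInf_csSup hb' ha') (hopen x)

/-- On open sets, `μ_f` is approximated from below by the quadratic variation of `f` along fine
families of intervals. -/
lemma exists_fam_of_lt_mu (f : V2) {V : Set I} (hV : IsOpen V) {θ η : ℝ}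
    (hθ : θ < (mu f).real V) (hη : 0 < η) :
    ∃ s, IsFam s ∧ Fine s η ∧ hull s ⊆ V ∧ θ < qv f s := by
  classical
  by_cases hθ0 : θ < 0
  · exact ⟨∅, ⟨by simp, by simp⟩, by simp [Fine], by simp [hull], by simpa [qv] using hθ0⟩
  push Not at hθ0
  obtain ⟨W, hW, rfl⟩ := isOpen_induced_iff.1 hV
  -- Bounded components are needed, and nothing is lost because `[0,1]` lies inside `(-1, 2)`.
  set W' := W ∩ Ioo (-1) 2 with hW'
  have hW'o : IsOpen W' := hW.inter isOpen_Ioo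
  have hlt : ENNReal.ofReal θ < muReal f W' := by
    have h1 : mu f (Subtype.val ⁻¹' W) ≤ muReal f W' := by
      rw [mu_apply]
      apply measure_mono
      rintro _ ⟨x, hx, rfl⟩
      exact ⟨hx, by have := x.2.1; linarith, by have := x.2.2; linarith⟩
    refine lt_of_lt_of_le ?_ h1
    rw [ENNReal.ofReal_lt_iff_lt_toReal hθ0 (measure_ne_top _ _)]
    exact hθ
  obtain ⟨𝒞, hc, hd, hU, hI⟩ := exists_countable_Ioo hW'o
    (bddBelow_Ioo.mono inter_subset_right) (bddAbove_Ioo.mono inter_subset_right)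
  have hfin : ∀ C : 𝒞, muReal f C.1 ≠ ⊤ := by
    rintro ⟨C, hC⟩
    obtain ⟨a, b, rfl⟩ := hI C hC
    rw [muReal, StieltjesFunction.measure_Ioo]
    exact ENNReal.ofReal_ne_top
  rw [← hU, measure_sUnion hc hd (fun C hC => by
    obtain ⟨a, b, rfl⟩ := hI C hC; exact measurableSet_Ioo), ENNReal.tsum_eq_iSup_sum,
    lt_iSup_iff] at hlt
  obtain ⟨t, ht⟩ := hlt
  rw [ENNReal.ofReal_lt_iff_lt_toReal hθ0 (ENNReal.sum_ne_top.2 fun C _ => hfin C),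
    ENNReal.toReal_sum fun C _ => hfin C] at ht
  set κ := (∑ C ∈ t, ((muReal f) C.1).toReal - θ) / (t.card + 1) with hκ
  have hκ0 : 0 < κ := div_pos (by linarith) (by positivity)
  have hκt : t.card * κ < ∑ C ∈ t, ((muReal f) C.1).toReal - θ := by
    have : (t.card + 1) * κ = ∑ C ∈ t, ((muReal f) C.1).toReal - θ := by
      rw [hκ]; field_simp
    linarith
  have key : ∀ C : 𝒞, ∃ s, IsFam s ∧ Fine s η ∧ hull s ⊆ Subtype.val ⁻¹' C.1 ∧
      ((muReal f) C.1).toReal - κ < qv f s := by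
    rintro ⟨C, hC⟩
    obtain ⟨a, b, rfl⟩ := hI C hC
    obtain ⟨s, h1, h2, h3, h4⟩ := exists_fam_Ioo f (a := a) (b := b)
      (θ := ((muReal f) (Ioo a b)).toReal - κ) (by rw [Measure.real]; linarith) hη
    refine ⟨s, h1, h2, ?_, h4⟩
    intro x hx
    simp only [hull, mem_iUnion] at hx
    obtain ⟨p, hp, hx⟩ := hx
    exact ⟨(h3 p hp).1.trans_le hx.1, lt_of_le_of_lt hx.2 (h3 p hp).2⟩
  choose s hs1 hs2 hs3 hs4 using key
  have hdis : ∀ C ∈ t, ∀ C' ∈ t, C ≠ C' → Disjoint (hull (s C)) (hull (s C')) := by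
    intro C _ C' _ hne
    exact ((hd C.2 C'.2 fun h => hne (Subtype.ext h)).preimage _).mono (hs3 C) (hs3 C')
  obtain ⟨h1, h2⟩ := IsFam.biUnion (fun C _ => hs1 C) hdis
  refine ⟨t.biUnion s, h1, ?_, ?_, ?_⟩
  · intro p hp
    obtain ⟨C, -, hp⟩ := Finset.mem_biUnion.1 hp
    exact hs2 C p hp
  · rw [hull_biUnion]
    refine iUnion₂_subset fun C _ => (hs3 C).trans (preimage_mono ?_)
    exact (subset_sUnion_of_mem C.2).trans (hU.subset.trans inter_subset_left)
  · rw [h2]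
    have := Finset.sum_le_sum fun C (_ : C ∈ t) => (hs4 C).le
    rw [Finset.sum_sub_distrib, Finset.sum_const, nsmul_eq_mul] at this
    linarith

/-- The quadratic variation of `f` along fine families of intervals is almost bounded by `μ_f`. -/
lemma exists_qv_le_mu_hull (f : V2) {ε : ℝ} (hε : 0 < ε) :
    ∃ η > 0, ∀ s, IsFam s → Fine s η → qv f s ≤ (mu f).real (hull s) + ε := by
  classical
  obtain ⟨η, hη, hle⟩ := exists_qv_le_distTilde f 1 (half_pos hε)
  have hd : distTilde f 1 = (mu f).real univ := by
    rw [mu_univ, distTilde, if_neg (by norm_num)]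
    congr 1
    exact eq_univ_of_forall fun s => s.2.2
  -- The open complement of `hull s` carries a fine family `s'` with almost all of its mass. As `s`
  -- and `s'` together cannot exceed the total mass by more than `ε / 2`, only the mass of `hull s`,
  -- up to `ε`, is left for `s`.
  refine ⟨η, hη, fun s hs hf => ?_⟩
  obtain ⟨s', h1, h2, h3, h4⟩ := exists_fam_of_lt_mu f (isClosed_hull s).isOpen_compl
    (θ := (mu f).real (hull s)ᶜ - ε / 2) (by linarith) hη
  have hdis : Disjoint (hull s) (hull s') := disjoint_compl_right.mono_right h3
  obtain ⟨h5, h6⟩ := IsFam.biUnion (t := Finset.univ) (s := fun b : Bool => if b then s else s')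
    (by rintro (_ | _) _ <;> simp [h1, hs])
    (by rintro (_ | _) _ (_ | _) _ hne <;> simp_all [hdis.symm])
  have h7 := hle _ h5 (by
    intro p hp
    obtain ⟨b, -, hp⟩ := Finset.mem_biUnion.1 hp
    cases b
    · exact h2 p (by simpa using hp)
    · exact hf p (by simpa using hp)) (fun p _ => p.2.2.2)
  rw [h6, Fintype.sum_bool] at h7
  simp only [if_true, Bool.false_eq_true, if_false] at h7
  rw [hd, ← measureReal_add_measureReal_compl (isClosed_hull s).measurableSet] at h7
  linarith

/-! ### Discrete and diffuse parts -/

/-- The diffuse part of a measure. -/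
noncomputable def diffusePart (μ : Measure I) : Measure I := μ.restrict {x | μ {x} ≠ 0}ᶜ

lemma countable_atoms (μ : Measure I) [IsFiniteMeasure μ] : {x | μ {x} ≠ 0}.Countable := by
  simpa [pos_iff_ne_zero] using Measure.countable_meas_pos_of_disjoint_iUnion (μ := μ)
    (As := fun x : I => {x}) (fun x => measurableSet_singleton x)
    (fun x y h => by simpa [Function.onFun] using h)

instance (μ : Measure I) [IsFiniteMeasure μ] : IsFiniteMeasure (diffusePart μ) := by
  unfold diffusePart; infer_instance

instance (μ : Measure I) [IsFiniteMeasure μ] : IsFiniteMeasure (discretePart μ) := by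
  unfold discretePart; infer_instance

instance (μ : Measure I) [IsFiniteMeasure μ] : NullSingletonClass (diffusePart μ) := by
  constructor
  intro x
  rw [diffusePart, Measure.restrict_apply (measurableSet_singleton x)]
  by_cases h : μ {x} = 0
  · exact measure_mono_null inter_subset_left h
  · have : {x} ∩ {x | μ {x} ≠ 0}ᶜ = ∅ := by
      ext y
      simp only [mem_inter_iff, mem_singleton_iff, mem_compl_iff, mem_empty_iff_false, iff_false]
      rintro ⟨rfl, h'⟩
      exact h' h
    rw [this, measure_empty]

/-- All atoms are charged, even those outside `S`; this is the source of the additive error in terms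
of `μ_f^d`. -/
lemma measure_le_discrete_add_diffuse (μ : Measure I) [IsFiniteMeasure μ] (S : Set I) :
    μ.real S ≤ (discretePart μ).real univ + (diffusePart μ).real S := by
  have h := (countable_atoms μ).measurableSet
  have e : μ = discretePart μ + diffusePart μ := (Measure.restrict_add_restrict_compl h).symm
  calc μ.real S = (discretePart μ + diffusePart μ).real S := by rw [← e]
    _ = (discretePart μ).real S + (diffusePart μ).real S := measureReal_add_apply
    _ ≤ _ := add_le_add_left (measureReal_mono (subset_univ S)) _

lemma measure_finite_le_discrete (μ : Measure I) [IsFiniteMeasure μ] {E : Set I} (hE : E.Finite) :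
    μ.real E ≤ (discretePart μ).real univ := by
  have h := measure_le_discrete_add_diffuse μ E
  have h0 : (diffusePart μ).real E = 0 := by
    rw [Measure.real, hE.measure_zero, ENNReal.toReal_zero]
  linarith

lemma discretePart_le (μ : Measure I) [IsFiniteMeasure μ] :
    (discretePart μ).real univ ≤ μ.real univ := by
  rw [discretePart, measureReal_restrict_apply MeasurableSet.univ]
  exact measureReal_mono (subset_univ _)

/-- Points are null for the diffuse part, so by outer regularity they have neighbourhoods of small
mass; a Lebesgue number makes the radius uniform. -/
lemma exists_diffuse_ball_le (μ : Measure I) [IsFiniteMeasure μ] {ε : ℝ} (hε : 0 < ε) :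
    ∃ r > 0, ∀ x, (diffusePart μ).real (Metric.ball x r) ≤ ε := by
  have h : ∀ x : I, ∃ U, U ⊇ {x} ∧ IsOpen U ∧ diffusePart μ U < ENNReal.ofReal ε := fun x =>
    ({x} : Set I).exists_isOpen_lt_of_lt _ (by rw [measure_singleton]; simpa using hε)
  choose U hxU hU hlt using h
  obtain ⟨r, hr, hball⟩ := lebesgue_number_lemma_of_metric (isCompact_univ (X := I)) hU
    fun x _ => mem_iUnion.2 ⟨x, hxU x rfl⟩
  refine ⟨r, hr, fun x => ?_⟩
  obtain ⟨i, hi⟩ := hball x (mem_univ x)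
  have := (measure_mono hi).trans (hlt i).le
  exact ENNReal.toReal_le_of_le_ofReal hε.le this

/-! ### Functions near `f` and families of long intervals -/

/-- The values of `g` lie, up to `ε`, between the bounds of `f` on the balls of radius `r`. -/
def Near (f : I → ℝ) (r ε : ℝ) (g : I → ℝ) : Prop :=
  ∀ x, (∃ y ∈ Metric.ball x r, g x ≤ f y + ε) ∧ ∃ y ∈ Metric.ball x r, f y - ε ≤ g x

lemma Near.mono {f g : I → ℝ} {r r' ε ε' : ℝ} (h : Near f r ε g) (hr : r ≤ r') (hε : ε ≤ ε') :
    Near f r' ε' g := by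
  intro x
  obtain ⟨⟨y, hy, h1⟩, ⟨z, hz, h2⟩⟩ := h x
  exact ⟨⟨y, Metric.ball_subset_ball hr hy, by linarith⟩,
    ⟨z, Metric.ball_subset_ball hr hz, by linarith⟩⟩

/-- This turns the deviation of `g` from `f` into an increment of `f` itself, to which `μ_f`
applies. -/
lemma Near.abs_sub_le {f g : I → ℝ} {r ε : ℝ} (h : Near f r ε g) (x : I) :
    ∃ y ∈ Metric.ball x r, |f x - g x| ≤ |f y - f x| + ε := by
  obtain ⟨⟨y, hy, h1⟩, ⟨z, hz, h2⟩⟩ := h x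
  rcases le_total (g x) (f x) with hle | hle
  · refine ⟨z, hz, ?_⟩
    rw [abs_of_nonneg (sub_nonneg.2 hle), abs_sub_comm]
    have := le_abs_self (f x - f z); linarith
  · refine ⟨y, hy, ?_⟩
    rw [abs_sub_comm, abs_of_nonneg (sub_nonneg.2 hle)]
    have := le_abs_self (f y - f x); linarith

lemma isFam_singleton {a b : I} (h : a < b) : IsFam {(a, b)} := by
  refine ⟨by simpa using h, fun p hp q hq hpq => ?_⟩
  simp only [Finset.mem_singleton] at hp hq
  exact absurd (hp.trans hq.symm) hpq

/-- The increments of `f` from the points of an `η`-separated set to nearby points have a square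
sum that is almost bounded by the mass of the discrete part of `μ_f`. -/
lemma exists_radius_sum_sq_le (f : V2) {η ε : ℝ} (hη : 0 < η) (hε : 0 < ε) :
    ∃ r > 0, ∀ T : Finset I, (∀ x ∈ T, ∀ y ∈ T, x ≠ y → η ≤ dist x y) → T.card * η ≤ 1 →
      ∀ y : I → I, (∀ x, y x ∈ Metric.ball x r) →
        ∑ x ∈ T, (f (y x) - f x) ^ 2 ≤ (discretePart (mu f)).real univ + ε := by
  classical
  obtain ⟨ηB, hηB, hB⟩ := exists_qv_le_mu_hull f (half_pos hε)
  obtain ⟨ρ, hρ, hball⟩ := exists_diffuse_ball_le (mu f) (ε := ε / 2 * η) (by positivity)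
  -- `η / 2` makes the balls disjoint, `ηB` makes the increments fine, and `ρ` makes the diffuse
  -- mass of each ball at most `ε / 2 * η`, hence at most `ε / 2` in total.
  refine ⟨min (η / 2) (min ηB ρ), by positivity, fun T hT hcard y hy => ?_⟩
  set r := min (η / 2) (min ηB ρ) with hr
  set T' := T.filter fun x => y x ≠ x with hT'
  set s : I → Finset (I × I) := fun x => {(min x (y x), max x (y x))} with hs
  have hsfam : ∀ x ∈ T', IsFam (s x) := by
    intro x hx
    apply isFam_singleton
    rw [min_lt_max]
    exact (Finset.mem_filter.1 hx).2.symm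
  have hhull : ∀ x, hull (s x) ⊆ Metric.ball x r := by
    intro x z hz
    simp only [hull, hs, Finset.mem_singleton, iUnion_iUnion_eq_left, mem_Icc] at hz
    have hyx := hy x
    rw [Metric.mem_ball, Subtype.dist_eq, Real.dist_eq, abs_lt] at hyx ⊢
    have h1 : min (x : ℝ) (y x) ≤ z := by
      have := hz.1
      rcases le_total x (y x) with h | h
      · rw [min_eq_left h] at this
        exact (min_le_left _ _).trans this
      · rw [min_eq_right h] at this
        exact (min_le_right _ _).trans this
    have h2 : (z : ℝ) ≤ max (x : ℝ) (y x) := by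
      have := hz.2
      rcases le_total x (y x) with h | h
      · rw [max_eq_right h] at this
        exact le_max_of_le_right this
      · rw [max_eq_left h] at this
        exact le_max_of_le_left this
    rcases le_total (x : ℝ) (y x) with h | h
    · rw [min_eq_left h] at h1; rw [max_eq_right h] at h2
      constructor <;> linarith
    · rw [min_eq_right h] at h1; rw [max_eq_left h] at h2
      constructor <;> linarith
  have hdis : ∀ x ∈ T', ∀ x' ∈ T', x ≠ x' → Disjoint (hull (s x)) (hull (s x')) := by
    intro x hx x' hx' hne
    refine (Metric.ball_disjoint_ball ?_).mono (hhull x) (hhull x')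
    have := hT x (Finset.mem_filter.1 hx).1 x' (Finset.mem_filter.1 hx').1 hne
    have : r ≤ η / 2 := min_le_left _ _
    linarith
  obtain ⟨h1, h2⟩ := IsFam.biUnion hsfam hdis
  have h3 := hB _ h1 (by
    intro p hp
    obtain ⟨x, -, hp⟩ := Finset.mem_biUnion.1 hp
    simp only [hs, Finset.mem_singleton] at hp
    subst hp
    have hyx := hy x
    rw [Metric.mem_ball, Subtype.dist_eq, Real.dist_eq, abs_lt] at hyx
    have hrB : r ≤ ηB := (min_le_right _ _).trans (min_le_left _ _)
    rcases le_total x (y x) with h | h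
    · simp only [min_eq_left h, max_eq_right h]; linarith
    · simp only [min_eq_right h, max_eq_left h]; linarith)
  have h4 : ∑ x ∈ T, (f (y x) - f x) ^ 2 = qv f (T'.biUnion s) := by
    rw [h2, hT', Finset.sum_filter]
    refine Finset.sum_congr rfl fun x _ => ?_
    split_ifs with h
    · simp only [qv, hs, Finset.sum_singleton]
      rcases le_total x (y x) with h | h
      · rw [min_eq_left h, max_eq_right h]
      · rw [min_eq_right h, max_eq_left h]; ring
    · rw [not_not.1 h]; simp
  have h5 : (diffusePart (mu f)).real (hull (T'.biUnion s)) ≤ ε / 2 := by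
    rw [hull_biUnion]
    calc (diffusePart (mu f)).real (⋃ x ∈ T', hull (s x))
        ≤ ∑ x ∈ T', (diffusePart (mu f)).real (hull (s x)) :=
          measureReal_biUnion_finset_le _ _
      _ ≤ ∑ x ∈ T', ε / 2 * η := by
          refine Finset.sum_le_sum fun x _ => ?_
          refine (measureReal_mono ((hhull x).trans (Metric.ball_subset_ball ?_))).trans (hball x)
          exact (min_le_right _ _).trans (min_le_right _ _)
      _ = T'.card * η * (ε / 2) := by rw [Finset.sum_const, nsmul_eq_mul]; ring
      _ ≤ T.card * η * (ε / 2) := by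
          have : (T'.card : ℝ) ≤ T.card := by
            exact_mod_cast Finset.card_le_card (Finset.filter_subset _ _)
          gcongr
      _ ≤ 1 * (ε / 2) := by gcongr
      _ = ε / 2 := one_mul _
  have h6 := measure_le_discrete_add_diffuse (mu f) (hull (T'.biUnion s))
  linarith

lemma V2.abs_sub_le (f : V2) (x y : I) : |f x - f y| ≤ 2 * ‖f‖ := by
  have h1 := abs_le.1 (f.abs_apply_le_norm x)
  have h2 := abs_le.1 (f.abs_apply_le_norm y)
  rw [abs_le]; constructor <;> linarith

/-- A function that is near enough to `f` differs from `f`, along families of long intervals, by a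
quadratic variation controlled by the discrete part of `μ_f`. -/
lemma exists_near_qv_le (f : V2) {η ε : ℝ} (hη : 0 < η) (hε : 0 < ε) :
    ∃ r > 0, ∃ κ > 0, ∀ g : I → ℝ, Near f r κ g → ∀ s, IsFam s →
      (∀ p ∈ s, η ≤ (p.2 : ℝ) - p.1) →
        qv (⇑f - g) s ≤ 4 * (discretePart (mu f)).real univ + ε := by
  classical
  obtain ⟨r, hr, H⟩ := exists_radius_sum_sq_le f hη (show 0 < ε / 8 by positivity)
  -- For an increment `a ≤ 2‖f‖` and `κ ≤ 1`, squaring `a + κ` costs at most `κ * (4‖f‖ + 1)`.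
  set κ := min 1 (ε / 8 * η / (4 * ‖f‖ + 1)) with hκ
  have hA : 0 < 4 * ‖f‖ + 1 := by positivity
  have hκ0 : 0 < κ := by positivity
  have hκ2 : κ * (4 * ‖f‖ + 1) ≤ ε / 8 * η := by
    rw [← le_div_iff₀ hA]; exact min_le_right _ _
  refine ⟨r, hr, κ, hκ0, fun g hg s hs hlong => ?_⟩
  choose y hy hyle using hg.abs_sub_le
  set D := (discretePart (mu f)).real univ with hD
  have hcard := hs.card_mul_le hlong
  have key : ∀ T : Finset I, (∀ x ∈ T, ∀ y ∈ T, x ≠ y → η ≤ dist x y) → T.card * η ≤ 1 →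
      ∑ x ∈ T, (f x - g x) ^ 2 ≤ D + ε / 4 := by
    intro T hT hTc
    have h1 := H T hT hTc y hy
    have h2 : ∀ x ∈ T, (f x - g x) ^ 2 ≤ (f (y x) - f x) ^ 2 + ε / 8 * η := by
      intro x _
      have h3 := hyle x
      have h4 := f.abs_sub_le (y x) x
      have h5 : κ ≤ 1 := min_le_left _ _
      rw [← sq_abs (f x - g x), ← sq_abs (f (y x) - f x)]
      have h6 := abs_nonneg (f x - g x)
      have h7 := abs_nonneg (f (y x) - f x)
      nlinarith
    have h3 := Finset.sum_le_sum h2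
    rw [Finset.sum_add_distrib, Finset.sum_const, nsmul_eq_mul] at h3
    have h4 : T.card * (ε / 8 * η) ≤ ε / 8 := by nlinarith
    linarith
  -- Left endpoints are separated from one another, and so are right endpoints, but a right endpoint
  -- may be the next left one. The two kinds are summed apart, which gives the factor `4`.
  have inj1 : ∀ p ∈ s, ∀ q ∈ s, p ≠ q → η ≤ dist p.1 q.1 := by
    intro p hp q hq hpq
    have h1 := hlong p hp
    have h2 := hlong q hq
    rw [Subtype.dist_eq, Real.dist_eq]
    rcases hs.2 p hp q hq hpq with h | h
    · have h' : (p.2 : ℝ) ≤ q.1 := h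
      rw [abs_sub_comm]; have := le_abs_self ((q.1 : ℝ) - p.1); linarith
    · have h' : (q.2 : ℝ) ≤ p.1 := h
      have := le_abs_self ((p.1 : ℝ) - q.1); linarith
  have inj2 : ∀ p ∈ s, ∀ q ∈ s, p ≠ q → η ≤ dist p.2 q.2 := by
    intro p hp q hq hpq
    have h1 := hlong p hp
    have h2 := hlong q hq
    rw [Subtype.dist_eq, Real.dist_eq]
    rcases hs.2 p hp q hq hpq with h | h
    · have h' : (p.2 : ℝ) ≤ q.1 := h
      rw [abs_sub_comm]; have := le_abs_self ((q.2 : ℝ) - p.2); linarith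
    · have h' : (q.2 : ℝ) ≤ p.1 := h
      have := le_abs_self ((p.2 : ℝ) - q.2); linarith
  have half : ∀ φ : I × I → I, (∀ p ∈ s, ∀ q ∈ s, p ≠ q → η ≤ dist (φ p) (φ q)) →
      ∑ p ∈ s, (f (φ p) - g (φ p)) ^ 2 ≤ D + ε / 4 := by
    intro φ hφ
    have hinj : Set.InjOn φ s := by
      intro p hp q hq hpq
      by_contra hne
      have := hφ p hp q hq hne
      rw [hpq, dist_self] at this
      linarith
    rw [← Finset.sum_image (f := fun x => (f x - g x) ^ 2) hinj]
    apply key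
    · intro x hx x' hx' hne
      obtain ⟨p, hp, rfl⟩ := Finset.mem_image.1 hx
      obtain ⟨q, hq, rfl⟩ := Finset.mem_image.1 hx'
      exact hφ p hp q hq fun h => hne (by rw [h])
    · rwa [Finset.card_image_of_injOn hinj]
  have h1 := half _ inj1
  have h2 := half _ inj2
  have h3 : qv (⇑f - g) s ≤ 2 * ∑ p ∈ s, (f p.1 - g p.1) ^ 2 + 2 * ∑ p ∈ s, (f p.2 - g p.2) ^ 2 := by
    rw [qv, Finset.mul_sum, Finset.mul_sum, ← Finset.sum_add_distrib]
    refine Finset.sum_le_sum fun p _ => ?_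
    simp only [Pi.sub_apply]
    nlinarith [sq_nonneg ((f p.1 - g p.1) + (f p.2 - g p.2))]
  linarith

/-! ### Convex combinations of the tails of a sequence -/

lemma sum_union_combo {M : Type*} [AddCommGroup M] [Module ℝ M] (S T : Finset ℕ) (w v : ℕ → ℝ)
    (a b : ℝ) (z : ℕ → M) :
    ∑ i ∈ S ∪ T, (a * (if i ∈ S then w i else 0) + b * (if i ∈ T then v i else 0)) • z i =
      a • ∑ i ∈ S, w i • z i + b • ∑ i ∈ T, v i • z i := by
  simp only [add_smul, Finset.sum_add_distrib, mul_smul, ← Finset.smul_sum, ite_smul, zero_smul]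
  rw [Finset.sum_ite_mem, Finset.sum_ite_mem, Finset.inter_eq_right.2 Finset.subset_union_left,
    Finset.inter_eq_right.2 Finset.subset_union_right]

/-- Combinations with different supports are merged by extending the weights by zero. -/
lemma exists_weights {E : Type*} [AddCommGroup E] [Module ℝ E] {u : ℕ → E} {N : ℕ} {h : E}
    (hh : h ∈ convexHull ℝ (u '' Ici N)) :
    ∃ (S : Finset ℕ) (w : ℕ → ℝ), (∀ i ∈ S, N ≤ i) ∧ (∀ i, 0 ≤ w i) ∧ ∑ i ∈ S, w i = 1 ∧
      h = ∑ i ∈ S, w i • u i := by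
  classical
  suffices H : convexHull ℝ (u '' Ici N) ⊆ {h | ∃ (S : Finset ℕ) (w : ℕ → ℝ), (∀ i ∈ S, N ≤ i) ∧
      (∀ i, 0 ≤ w i) ∧ ∑ i ∈ S, w i = 1 ∧ h = ∑ i ∈ S, w i • u i} from H hh
  refine convexHull_min ?_ ?_
  · rintro _ ⟨n, hn, rfl⟩
    exact ⟨{n}, fun _ => 1, by simpa using hn, fun _ => zero_le_one, by simp, by simp⟩
  · rintro x ⟨S, w, hS, hw, hw1, rfl⟩ y ⟨T, v, hT, hv, hv1, rfl⟩ a b ha hb hab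
    refine ⟨S ∪ T, fun i => a * (if i ∈ S then w i else 0) + b * (if i ∈ T then v i else 0),
      ?_, ?_, ?_, (sum_union_combo S T w v a b u).symm⟩
    · intro i hi
      rcases Finset.mem_union.1 hi with h | h
      · exact hS i h
      · exact hT i h
    · intro i
      have := hw i
      have := hv i
      positivity
    · have := sum_union_combo S T w v a b fun _ => (1 : ℝ)
      simp only [smul_eq_mul, mul_one, hw1, hv1] at this
      rw [this, hab]

open CompactlySupported CompactlySupportedContinuousMap in
/-- **Mazur's lemma** for a bounded sequence of non-negative continuous functions that converges
pointwise to zero. -/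
lemma exists_convexHull_lt {e : ℕ → C(I, ℝ)} (h0 : ∀ n x, 0 ≤ e n x) {B : ℝ}
    (hB : ∀ n x, e n x ≤ B) (hlim : ∀ x, Tendsto (fun n => e n x) atTop (𝓝 0)) {ε : ℝ}
    (hε : 0 < ε) (N : ℕ) : ∃ g ∈ convexHull ℝ (e '' Ici N), ∀ x, g x < ε := by
  by_contra! hcon
  set U : Set C(I, ℝ) := {g | ∀ x, g x < ε} with hU
  have hUo : IsOpen U := by
    have := ContinuousMap.isOpen_setOfPred_mapsTo (X := I) (Y := ℝ) isCompact_univ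
      (isOpen_Iio (a := ε))
    convert this using 1
    ext g
    simp [hU, MapsTo]
  have hUc : Convex ℝ U := by
    intro g hg g' hg' a b ha hb hab x
    have h1 := hg x
    have h2 := hg' x
    simp only [ContinuousMap.add_apply, ContinuousMap.smul_apply, smul_eq_mul]
    rcases ha.eq_or_lt with rfl | ha
    · rw [zero_add] at hab; subst hab; simpa using h2
    · nlinarith
  -- A functional bounded above on `U`, which contains all non-positive functions, is positive,
  -- hence integration against a measure. Dominated convergence then sends `ψ (e n)` to `0`, against
  -- `c ≤ ψ (e n)` with `c > 0`.
  obtain ⟨ψ, c, hψU, hψK⟩ := geometric_hahn_banach_open hUc hUo (convex_convexHull ℝ (e '' Ici N))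
    (Set.disjoint_left.2 fun g hg hgK => by
      obtain ⟨x, hx⟩ := hcon g hgK
      exact absurd (hg x) (not_lt.2 hx))
  have hc : 0 < c := by
    have := hψU 0 fun x => by simpa using hε
    simpa using this
  have hpos : ∀ p : C(I, ℝ), (∀ x, 0 ≤ p x) → 0 ≤ ψ p := by
    intro p hp
    by_contra! hneg
    have h1 := hψU ((c / ψ p) • p) fun x => by
      simp only [ContinuousMap.smul_apply, smul_eq_mul]
      have : c / ψ p * p x ≤ 0 :=
        mul_nonpos_of_nonpos_of_nonneg (div_nonpos_of_nonneg_of_nonpos hc.le hneg.le) (hp x)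
      linarith
    rw [map_smul, smul_eq_mul, div_mul_cancel₀ _ hneg.ne] at h1
    exact lt_irrefl _ h1
  let Λ : C_c(I, ℝ) →ₚ[ℝ] ℝ :=
    { toFun g := ψ g.toContinuousMap
      map_add' g g' := ψ.map_add _ _
      map_smul' c g := ψ.map_smul _ _
      monotone' g g' hgg' := by
        have := hpos (g'.toContinuousMap - g.toContinuousMap) fun x => sub_nonneg.2 (hgg' x)
        rw [map_sub] at this
        exact sub_nonneg.1 this }
  have hint : ∀ g : C(I, ℝ), ∫ x, g x ∂(RealRMK.rieszMeasure Λ) = ψ g := fun g =>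
    RealRMK.integral_rieszMeasure Λ
      { toFun := g, hasCompactSupport' := HasCompactSupport.of_compactSpace _ }
  have hconv : Tendsto (fun n => ∫ x, e n x ∂(RealRMK.rieszMeasure Λ)) atTop
      (𝓝 (∫ _, (0 : ℝ) ∂(RealRMK.rieszMeasure Λ))) := by
    refine tendsto_integral_of_dominated_convergence (fun _ => B)
      (fun n => (e n).continuous.aestronglyMeasurable) (integrable_const B) ?_ ?_
    · intro n
      refine Eventually.of_forall fun x => ?_
      rw [Real.norm_of_nonneg (h0 n x)]
      exact hB n x
    · exact Eventually.of_forall hlim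
  rw [integral_zero] at hconv
  obtain ⟨n, hn, hnN⟩ := ((hconv.eventually (gt_mem_nhds hc)).and (eventually_ge_atTop N)).exists
  rw [hint] at hn
  exact absurd (hψK (e n) (subset_convexHull ℝ _ (mem_image_of_mem e hnN))) (not_le.2 hn)

/-- The sup-convolution of a bounded function with a steep cone is a continuous majorant. -/
lemma exists_continuous_majorant {φ : I → ℝ} {A : ℝ} (hA : ∀ x y, φ x - φ y ≤ A)
    {r : ℝ} (hr : 0 < r) :
    ∃ U : C(I, ℝ), (∀ x, φ x ≤ U x) ∧ (∀ x, U x ≤ φ 0 + A) ∧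
      ∀ x, ∀ ε > 0, ∃ y ∈ Metric.ball x r, U x ≤ φ y + ε := by
  have hA0 : 0 ≤ A := by simpa using hA 0 0
  -- With this slope the penalty at distance `r` is `A + 1`, more than `φ` can gain; points whose
  -- value is within `1` of the supremum therefore lie in the ball.
  set κ : NNReal := ⟨(A + 1) / r, by positivity⟩ with hκ
  have hκr : (κ : ℝ) * r = A + 1 := div_mul_cancel₀ _ hr.ne'
  have hb : ∀ x y, φ y - κ * dist x y ≤ φ 0 + A := fun x y => by
    have := hA y 0
    have : 0 ≤ (κ : ℝ) * dist x y := by positivity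
    linarith
  have hbdd : ∀ x, BddAbove (range fun y => φ y - κ * dist x y) := fun x =>
    ⟨φ 0 + A, by rintro _ ⟨y, rfl⟩; exact hb x y⟩
  set U : I → ℝ := fun x => ⨆ y, (φ y - κ * dist x y) with hU
  have hUlip : LipschitzWith κ U := by
    refine LipschitzWith.of_le_add_mul κ fun x y => ciSup_le fun z => ?_
    have h1 : φ z - κ * dist y z ≤ U y := le_ciSup (hbdd y) z
    have h2 : (κ : ℝ) * dist y z ≤ κ * (dist x y + dist x z) := by
      gcongr
      rw [dist_comm x y]; exact dist_triangle _ _ _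
    linarith
  have hφU : ∀ x, φ x ≤ U x := fun x => by
    have := le_ciSup (hbdd x) x
    simpa using this
  refine ⟨⟨U, hUlip.continuous⟩, hφU, fun x => ciSup_le fun y => hb x y, fun x ε hε => ?_⟩
  obtain ⟨y, hy⟩ := exists_lt_of_lt_ciSup
    (show U x - min ε 1 < ⨆ y, (φ y - κ * dist x y) by
      have : 0 < min ε 1 := by positivity
      simp only [hU]; linarith)
  have hm1 := min_le_left ε 1
  have hm2 := min_le_right ε 1
  have hd : 0 ≤ (κ : ℝ) * dist x y := by positivity
  refine ⟨y, ?_, ?_⟩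
  · rw [Metric.mem_ball, dist_comm]
    by_contra! h
    have h1 : (κ : ℝ) * r ≤ κ * dist x y := by gcongr
    have h2 := hA y x
    have h3 := hφU x
    linarith
  · simp only [ContinuousMap.coe_mk]; linarith

/-- The tails of a bounded sequence of continuous functions converging pointwise to `f` have convex
combinations near `f`. -/
lemma exists_convexHull_near (f : V2) {u : ℕ → V2} (hcont : ∀ n, Continuous (u n))
    (hbdd : BddAbove (range fun n => ‖u n‖))
    (hlim : ∀ t, Tendsto (fun n => u n t) atTop (𝓝 (f t))) {r ε : ℝ} (hr : 0 < r) (hε : 0 < ε)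
    (N : ℕ) : ∃ h ∈ convexHull ℝ (u '' Ici N), Near f r ε h := by
  obtain ⟨M, hM⟩ := hbdd
  have hM' : ∀ n x, |u n x| ≤ M := fun n x => ((u n).abs_apply_le_norm x).trans (hM ⟨n, rfl⟩)
  obtain ⟨U, hU1, hU2, hU3⟩ := exists_continuous_majorant (φ := f) (A := 2 * ‖f‖)
    (fun x y => (le_abs_self _).trans (f.abs_sub_le x y)) hr
  obtain ⟨L, hL1, hL2, hL3⟩ := exists_continuous_majorant (φ := fun x => -f x) (A := 2 * ‖f‖)
    (fun x y => (le_abs_self _).trans (by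
      have := f.abs_sub_le y x
      rwa [show -f x - -f y = f y - f x by ring])) hr
  -- The amount by which `u n` leaves the band between the continuous envelopes `-L ≤ f ≤ U`; it
  -- tends to `0` pointwise since `f` lies in the band.
  let e : ℕ → C(I, ℝ) := fun n =>
    ⟨fun x => max 0 (max (u n x - U x) (-L x - u n x)), by
      have := hcont n
      fun_prop⟩
  obtain ⟨g, hg, hgε⟩ := exists_convexHull_lt (e := e) (fun n x => le_max_left _ _)
    (B := max 0 (max (M - f 0 + 2 * ‖f‖) (f 0 + M + 2 * ‖f‖)))
    (fun n x => by
      have h1 := abs_le.1 (hM' n x)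
      have h2 := abs_le.1 (f.abs_sub_le x 0)
      have h3 := hU1 x
      have h4 := hL1 x
      refine max_le_max le_rfl (max_le_max ?_ ?_) <;> linarith)
    (fun x => by
      have h : Tendsto (fun n => max 0 (max (u n x - U x) (-L x - u n x))) atTop
          (𝓝 (max 0 (max (f x - U x) (-L x - f x)))) :=
        tendsto_const_nhds.max (((hlim x).sub_const _).max ((hlim x).const_sub _))
      have h0 : max 0 (max (f x - U x) (-L x - f x)) = 0 := by
        have h3 := hU1 x
        have h4 := hL1 x
        exact max_eq_left (max_le (by linarith) (by linarith))
      rw [h0] at h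
      exact h) (half_pos hε) N
  obtain ⟨S, w, hS, hw, hw1, rfl⟩ := exists_weights hg
  have hval : ∀ x, (∑ i ∈ S, w i • u i) x = ∑ i ∈ S, w i * u i x := fun x =>
    map_sum (evalCLM x) (fun i => w i • u i) S
  refine ⟨∑ i ∈ S, w i • u i, (convex_convexHull ℝ _).sum_mem (fun i _ => hw i) hw1
    fun i hi => subset_convexHull ℝ _ (mem_image_of_mem u (hS i hi)), fun x => ?_⟩
  have h1 : ∑ i ∈ S, w i * e i x < ε / 2 := by
    have := hgε x
    simpa using this
  have h2 : ∑ i ∈ S, w i * (u i x - U x) ≤ ∑ i ∈ S, w i * e i x :=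
    Finset.sum_le_sum fun i _ => mul_le_mul_of_nonneg_left
      ((le_max_left _ _).trans (le_max_right _ _)) (hw i)
  have h3 : ∑ i ∈ S, w i * (-L x - u i x) ≤ ∑ i ∈ S, w i * e i x :=
    Finset.sum_le_sum fun i _ => mul_le_mul_of_nonneg_left
      ((le_max_right _ _).trans (le_max_right _ _)) (hw i)
  simp only [mul_sub, Finset.sum_sub_distrib, ← Finset.sum_mul, hw1, one_mul] at h2 h3
  obtain ⟨y, hy, hy'⟩ := hU3 x (ε / 2) (half_pos hε)
  obtain ⟨z, hz, hz'⟩ := hL3 x (ε / 2) (half_pos hε)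
  rw [hval]
  exact ⟨⟨y, hy, by linarith⟩, ⟨z, hz, by linarith⟩⟩

/-! ### Averaging over many scales -/

/-- Young's inequality with a weight: a small `θ` keeps the factor of the main term close to `1`, so
that the coefficient of `μ_f` is not doubled at each splitting. -/
lemma add_sq_le_of_pos {θ : ℝ} (hθ : 0 < θ) (x y : ℝ) :
    (x + y) ^ 2 ≤ (1 + θ) * x ^ 2 + (1 + θ⁻¹) * y ^ 2 := by
  have h : 0 ≤ θ⁻¹ * (θ * x - y) ^ 2 := by positivity
  have e : θ⁻¹ * (θ * x - y) ^ 2 = θ * x ^ 2 - 2 * x * y + θ⁻¹ * y ^ 2 := by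
    field_simp
    ring
  nlinarith

lemma qv_add_le {θ : ℝ} (hθ : 0 < θ) (f g : I → ℝ) (s : Finset (I × I)) :
    qv (f + g) s ≤ (1 + θ) * qv f s + (1 + θ⁻¹) * qv g s := by
  simp only [qv, Finset.mul_sum, ← Finset.sum_add_distrib]
  refine Finset.sum_le_sum fun p _ => ?_
  refine le_trans (le_of_eq ?_) (add_sq_le_of_pos hθ _ _)
  simp only [Pi.add_apply]; ring

lemma qv_neg (f : I → ℝ) (s : Finset (I × I)) : qv (-f) s = qv f s :=
  Finset.sum_congr rfl fun p _ => by simp only [Pi.neg_apply]; ring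

/-- The average of functions `g₀, …, g_{N-1}` adapted to decreasing scales `c₀ ≥ c₁ ≥ ⋯`: the
increments of `g_i` are negligible on intervals shorter than `c_{i+1}`, those of `φ - g_i` are
controlled on intervals longer than `c_i`, and each interval lies between `c_{i+1}` and `c_i` for
at most one `i`. -/
lemma qv_sub_average_le {φ : I → ℝ} {g : ℕ → I → ℝ} {c : ℕ → ℝ} (hc : Antitone c)
    {N : ℕ} (hN : 0 < N) {s : Finset (I × I)} {θ A K P : ℝ} (hθ : 0 < θ)
    (hshort : ∀ i, qv (φ - g i) (s.filter fun p => (p.2 : ℝ) - p.1 < c (i + 1)) ≤ A)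
    (hlong : ∀ i, qv (φ - g i) (s.filter fun p => c i ≤ (p.2 : ℝ) - p.1) ≤ P)
    (hK : ∀ i, qv (φ - g i) s ≤ K) :
    qv (φ - fun x => (N : ℝ)⁻¹ * ∑ i ∈ Finset.range N, g i x) s ≤
      (1 + θ) * (A + P) + (1 + θ⁻¹) * (K / N) := by
  classical
  have hN0 : (0 : ℝ) < N := by exact_mod_cast hN
  set e : ℕ → I × I → ℝ := fun i p => (φ - g i) p.2 - (φ - g i) p.1 with he
  set mid : ℕ → I × I → Prop := fun i p => c (i + 1) ≤ (p.2 : ℝ) - p.1 ∧ (p.2 : ℝ) - p.1 < c i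
    with hmid
  -- `a` collects the controlled increments, `b` the uncontrolled ones of intermediate length. For
  -- `a`, Cauchy–Schwarz bounds the square of the average by the average of the squares.
  set a : ℕ → I × I → ℝ := fun i p => if mid i p then 0 else e i p with ha
  set b : ℕ → I × I → ℝ := fun i p => if mid i p then e i p else 0 with hb
  have hab : ∀ i p, e i p = a i p + b i p := fun i p => by
    simp only [ha, hb]; split_ifs <;> simp
  have hinc : ∀ p : I × I, (φ - fun x => (N : ℝ)⁻¹ * ∑ i ∈ Finset.range N, g i x) p.2 -
      (φ - fun x => (N : ℝ)⁻¹ * ∑ i ∈ Finset.range N, g i x) p.1 =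
      (N : ℝ)⁻¹ * ∑ i ∈ Finset.range N, a i p + (N : ℝ)⁻¹ * ∑ i ∈ Finset.range N, b i p := by
    intro p
    rw [← mul_add, ← Finset.sum_add_distrib]
    simp only [← hab, he, Pi.sub_apply, Finset.sum_sub_distrib, Finset.sum_const,
      Finset.card_range, nsmul_eq_mul]
    field_simp
  have hasq : ∀ p : I × I, ((N : ℝ)⁻¹ * ∑ i ∈ Finset.range N, a i p) ^ 2 ≤
      (N : ℝ)⁻¹ * ∑ i ∈ Finset.range N, a i p ^ 2 := by
    intro p
    have h := sq_sum_le_card_mul_sum_sq (s := Finset.range N) (f := fun i => a i p)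
    rw [Finset.card_range] at h
    calc ((N : ℝ)⁻¹ * ∑ i ∈ Finset.range N, a i p) ^ 2
        = (N : ℝ)⁻¹ ^ 2 * (∑ i ∈ Finset.range N, a i p) ^ 2 := mul_pow _ _ _
      _ ≤ (N : ℝ)⁻¹ ^ 2 * (N * ∑ i ∈ Finset.range N, a i p ^ 2) := by gcongr
      _ = _ := by field_simp
  -- At most one summand is nonzero, so the full factor `N⁻¹ ^ 2` survives, and summing over the `N`
  -- functions leaves `K / N`.
  have hbsq : ∀ p : I × I, ((N : ℝ)⁻¹ * ∑ i ∈ Finset.range N, b i p) ^ 2 ≤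
      (N : ℝ)⁻¹ ^ 2 * ∑ i ∈ Finset.range N, e i p ^ 2 := by
    intro p
    rw [mul_pow]
    refine mul_le_mul_of_nonneg_left ?_ (by positivity)
    by_cases hex : ∃ i ∈ Finset.range N, mid i p
    · obtain ⟨i, hi, hip⟩ := hex
      have huniq : ∀ j, mid j p → j = i := by
        intro j hj
        rcases lt_trichotomy j i with h | h | h
        · have := hc (show j + 1 ≤ i from h)
          have := hj.1; have := hip.2; linarith
        · exact h
        · have := hc (show i + 1 ≤ j from h)
          have := hip.1; have := hj.2; linarith
      rw [Finset.sum_eq_single i (fun j _ hj => by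
        simp only [hb]; rw [if_neg fun h => hj (huniq j h)]) (fun h => absurd hi h)]
      simp only [hb, if_pos hip]
      exact Finset.single_le_sum (f := fun i => e i p ^ 2) (fun _ _ => sq_nonneg _) hi
    · push Not at hex
      rw [Finset.sum_eq_zero fun i hi => by simp only [hb]; rw [if_neg (hex i hi)]]
      rw [zero_pow two_ne_zero]
      exact Finset.sum_nonneg fun _ _ => sq_nonneg _
  have hA : ∑ p ∈ s, ((N : ℝ)⁻¹ * ∑ i ∈ Finset.range N, a i p) ^ 2 ≤ A + P := by
    calc _ ≤ ∑ p ∈ s, (N : ℝ)⁻¹ * ∑ i ∈ Finset.range N, a i p ^ 2 :=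
          Finset.sum_le_sum fun p _ => hasq p
      _ = (N : ℝ)⁻¹ * ∑ i ∈ Finset.range N, ∑ p ∈ s, a i p ^ 2 := by
          rw [← Finset.mul_sum, Finset.sum_comm]
      _ ≤ (N : ℝ)⁻¹ * ∑ i ∈ Finset.range N, (A + P) := by
          gcongr with i _
          refine le_trans ?_ (add_le_add (hshort i) (hlong i))
          rw [qv, qv, Finset.sum_filter, Finset.sum_filter, ← Finset.sum_add_distrib]
          refine Finset.sum_le_sum fun p _ => ?_
          simp only [ha, hmid, he]
          split_ifs <;> first | nlinarith | (exfalso; tauto) | skip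
          all_goals rename_i h1 h2 h3; exact absurd ⟨not_lt.1 h2, not_le.1 h3⟩ h1
      _ = A + P := by
          rw [Finset.sum_const, Finset.card_range, nsmul_eq_mul]; field_simp
  have hB : ∑ p ∈ s, ((N : ℝ)⁻¹ * ∑ i ∈ Finset.range N, b i p) ^ 2 ≤ K / N := by
    calc _ ≤ ∑ p ∈ s, (N : ℝ)⁻¹ ^ 2 * ∑ i ∈ Finset.range N, e i p ^ 2 :=
          Finset.sum_le_sum fun p _ => hbsq p
      _ = (N : ℝ)⁻¹ ^ 2 * ∑ i ∈ Finset.range N, qv (φ - g i) s := by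
          rw [← Finset.mul_sum, Finset.sum_comm]; rfl
      _ ≤ (N : ℝ)⁻¹ ^ 2 * ∑ i ∈ Finset.range N, K := by
          gcongr with i _
          exact hK i
      _ = K / N := by
          rw [Finset.sum_const, Finset.card_range, nsmul_eq_mul]; field_simp
  calc qv (φ - fun x => (N : ℝ)⁻¹ * ∑ i ∈ Finset.range N, g i x) s
      ≤ ∑ p ∈ s, ((1 + θ) * ((N : ℝ)⁻¹ * ∑ i ∈ Finset.range N, a i p) ^ 2 +
          (1 + θ⁻¹) * ((N : ℝ)⁻¹ * ∑ i ∈ Finset.range N, b i p) ^ 2) := by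
        refine Finset.sum_le_sum fun p _ => ?_
        rw [hinc]
        exact add_sq_le_of_pos hθ _ _
    _ ≤ _ := by
        rw [Finset.sum_add_distrib, ← Finset.mul_sum, ← Finset.mul_sum]
        gcongr

/-- Of the two witnesses for an upper bound, the one with the larger value of `f` works for the
combination; dually for lower bounds. -/
lemma convex_near (f : I → ℝ) (r ε : ℝ) : Convex ℝ {h : V2 | Near f r ε h} := by
  intro g hg h hh a b ha hb hab x
  obtain ⟨⟨y, hy, h1⟩, ⟨z, hz, h2⟩⟩ := hg x
  obtain ⟨⟨y', hy', h1'⟩, ⟨z', hz', h2'⟩⟩ := hh x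
  have hb' : b = 1 - a := by linarith
  simp only [V2.coe_add, V2.coe_smul, Pi.add_apply, Pi.smul_apply, smul_eq_mul]
  constructor
  · rcases le_total (f y) (f y') with hle | hle
    · exact ⟨y', hy', by subst hb'; nlinarith⟩
    · exact ⟨y, hy, by subst hb'; nlinarith⟩
  · rcases le_total (f z) (f z') with hle | hle
    · exact ⟨z, hz, by subst hb'; nlinarith⟩
    · exact ⟨z', hz', by subst hb'; nlinarith⟩

lemma norm_le_of_mem_convexHull {u : ℕ → V2} {M : ℝ} (hM : ∀ n, ‖u n‖ ≤ M) {N : ℕ} {h : V2}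
    (hh : h ∈ convexHull ℝ (u '' Ici N)) : ‖h‖ ≤ M := by
  have : convexHull ℝ (u '' Ici N) ⊆ Metric.closedBall 0 M := by
    refine convexHull_min ?_ (convex_closedBall _ _)
    rintro _ ⟨n, -, rfl⟩
    simpa using hM n
  simpa using this hh

lemma mem_of_mem_convexHull {u : ℕ → V2} {X : Submodule ℝ V2} (hX : ∀ n, u n ∈ X) {N : ℕ} {h : V2}
    (hh : h ∈ convexHull ℝ (u '' Ici N)) : h ∈ X := by
  refine convexHull_min (t := (X : Set V2)) ?_ X.convex hh
  rintro _ ⟨n, -, rfl⟩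
  exact hX n

/-- The tails of a bounded sequence in `V₂⁰` converging pointwise to `f` have convex combinations
`h` near `f` such that the quadratic variation of `f - h` is dominated by `μ_f`. -/
lemma exists_convexHull_qv_le (f : V2) {u : ℕ → V2} (hu : ∀ n, u n ∈ V20)
    (hbdd : BddAbove (range fun n => ‖u n‖))
    (hlim : ∀ t, Tendsto (fun n => u n t) atTop (𝓝 (f t))) {ρ ε : ℝ} (hρ : 0 < ρ) (hε : 0 < ε)
    (N₀ : ℕ) : ∃ h ∈ convexHull ℝ (u '' Ici N₀), Near f ρ ε h ∧
      ∀ s, IsFam s → qv (⇑f - ⇑h) s ≤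
        (mu f).real (hull s) + 4 * (discretePart (mu f)).real univ + ε := by
  obtain ⟨M, hM⟩ := id hbdd
  have hM' : ∀ n, ‖u n‖ ≤ M := fun n => hM ⟨n, rfl⟩
  set D := (discretePart (mu f)).real univ with hD
  have hmu : (mu f).real univ ≤ ‖f‖ ^ 2 := by rw [mu_univ]; exact muTilde_univ_le f
  have hDle : D ≤ ‖f‖ ^ 2 := (discretePart_le _).trans hmu
  -- With all auxiliary errors at most `θ ^ 2`, the factor `1 + θ⁻¹` is harmless, and the total
  -- error comes to at most `θ * (7 * ‖f‖ ^ 2 + 12)`.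
  set θ := min 1 (ε / (7 * ‖f‖ ^ 2 + 12)) with hθ
  have hθ0 : 0 < θ := by positivity
  have hθ1 : θ ≤ 1 := min_le_left _ _
  have hθε : θ * (7 * ‖f‖ ^ 2 + 12) ≤ ε := by
    rw [← le_div_iff₀ (by positivity)]; exact min_le_right _ _
  obtain ⟨ηB, hηB, hB⟩ := exists_qv_le_mu_hull f (show 0 < θ ^ 2 by positivity)
  -- From a scale `η`: a `g` close enough to `f` for intervals longer than `η`, and then a scale
  -- `η'` below which this `g` is negligible.
  have step : ∀ η : {η : ℝ // 0 < η}, ∃ (g : V2) (η' : {η : ℝ // 0 < η}), η' ≤ η ∧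
      g ∈ convexHull ℝ (u '' Ici N₀) ∧ Near f ρ ε g ∧
      (∀ s, IsFam s → (∀ p ∈ s, (η : ℝ) ≤ (p.2 : ℝ) - p.1) → qv (⇑f - ⇑g) s ≤ 4 * D + θ ^ 2) ∧
      ∀ s, IsFam s → Fine s η' → qv g s ≤ θ ^ 2 := by
    rintro ⟨η, hη⟩
    obtain ⟨r, hr, κ, hκ, H⟩ := exists_near_qv_le f hη (show 0 < θ ^ 2 by positivity)
    obtain ⟨g, hg, hgn⟩ := exists_convexHull_near f (fun n => SquareAbsCont.continuous (hu n)) hbdd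
      hlim (lt_min hr hρ) (lt_min hκ hε) N₀
    obtain ⟨η', hη', hfine⟩ := SquareAbsCont.exists_fine (mem_of_mem_convexHull hu hg)
      (show 0 < θ ^ 2 by positivity)
    refine ⟨g, ⟨min η η', lt_min hη hη'⟩, Subtype.mk_le_mk.2 (min_le_left _ _), hg,
      hgn.mono (min_le_right _ _) (min_le_right _ _),
      H g (hgn.mono (min_le_left _ _) (min_le_left _ _)), fun s hs hf => ?_⟩
    exact (hfine s hs (hf.mono (min_le_right _ _))).le
  choose G E hE hGc hGn hGl hGs using step
  -- Starting at `ηB` makes all later scales fine enough for the bound of `f` by `μ_f`.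
  set η : ℕ → {η : ℝ // 0 < η} := fun n => Nat.rec ⟨ηB, hηB⟩ (fun _ x => E x) n with hη
  have hanti : Antitone fun i => (η i : ℝ) := antitone_nat_of_succ_le fun n => hE (η n)
  set K := (‖f‖ + M) ^ 2 with hK
  obtain ⟨N, hN⟩ := exists_nat_gt (K / θ ^ 2)
  have hN0 : (0 : ℝ) < N := lt_of_le_of_lt (by positivity) hN
  have hNpos : 0 < N := by exact_mod_cast hN0
  have hKN : K / N ≤ θ ^ 2 := by
    rw [div_lt_iff₀ (by positivity)] at hN
    rw [div_le_iff₀ hN0]; linarith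
  set h : V2 := ∑ i ∈ Finset.range N, (N : ℝ)⁻¹ • G (η i) with hh
  have hmem : h ∈ convexHull ℝ (u '' Ici N₀) ∩ {h : V2 | Near f ρ ε h} := by
    refine ((convex_convexHull ℝ _).inter (convex_near f ρ ε)).sum_mem
      (fun _ _ => by positivity) ?_ fun i _ => ⟨hGc _, hGn _⟩
    rw [Finset.sum_const, Finset.card_range, nsmul_eq_mul, mul_inv_cancel₀ hN0.ne']
  refine ⟨h, hmem.1, hmem.2, fun s hs => ?_⟩
  have hval : ⇑h = fun x => (N : ℝ)⁻¹ * ∑ i ∈ Finset.range N, G (η i) x := by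
    funext x
    rw [Finset.mul_sum]
    exact map_sum (evalCLM x) (fun i => (N : ℝ)⁻¹ • G (η i)) _
  set m := (mu f).real (hull s) with hm
  have hm0 : 0 ≤ m := measureReal_nonneg
  have hmle : m ≤ ‖f‖ ^ 2 := (measureReal_mono (subset_univ _)).trans hmu
  have key := qv_sub_average_le (φ := f) (g := fun i => G (η i)) hanti hNpos (s := s) (θ := θ)
    (A := (1 + θ) * (m + θ ^ 2) + (1 + θ⁻¹) * θ ^ 2) (K := K) (P := 4 * D + θ ^ 2) hθ0
    (fun i => by
      set t := s.filter fun p => (p.2 : ℝ) - p.1 < η (i + 1) with ht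
      have hts : t ⊆ s := Finset.filter_subset _ _
      have htf : Fine t (η (i + 1)) := fun p hp => (Finset.mem_filter.1 hp).2
      have h1 := hB t (hs.subset hts) (htf.mono (hanti (Nat.zero_le (i + 1))))
      have h2 := hGs (η i) t (hs.subset hts) htf
      have h3 : (mu f).real (hull t) ≤ m := measureReal_mono (hull_mono hts)
      have h4 := qv_add_le hθ0 f (-⇑(G (η i))) t
      rw [← sub_eq_add_neg, qv_neg] at h4
      refine h4.trans ?_
      gcongr
      linarith)
    (fun i => hGl (η i) _ (hs.subset (Finset.filter_subset _ _))
      fun p hp => (Finset.mem_filter.1 hp).2)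
    (fun i => by
      rw [← V2.coe_sub]
      refine (hs.qv_le _).trans ?_
      have h1 := norm_sub_le f (G (η i))
      have h2 := norm_le_of_mem_convexHull hM' (hGc (η i))
      exact pow_le_pow_left₀ (norm_nonneg _) (by linarith) 2)
  rw [hval]
  refine key.trans ?_
  have hθinv : (1 + θ⁻¹) * θ ^ 2 = θ ^ 2 + θ := by field_simp
  have hlast : (1 + θ⁻¹) * (K / N) ≤ θ ^ 2 + θ := by
    rw [← hθinv]; gcongr
  rw [hθinv]
  have hD0 : 0 ≤ D := measureReal_nonneg
  set A2 := ‖f‖ ^ 2 with hA2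
  have hA20 : 0 ≤ A2 := by positivity
  have t2 : θ ^ 2 ≤ θ := by nlinarith
  have e1 : θ * m ≤ θ * A2 := by gcongr
  have e2 : θ * D ≤ θ * A2 := by gcongr
  have t3 : θ * θ ^ 2 ≤ θ := by nlinarith [sq_nonneg θ]
  have hQ : (1 + θ) * (m + θ ^ 2) + (θ ^ 2 + θ) + (4 * D + θ ^ 2) ≤
      m + 4 * D + θ * (A2 + 5) := by linarith
  have hθm : θ * (θ * (A2 + 5)) ≤ 1 * (θ * (A2 + 5)) := by gcongr
  have hQ2 : (1 + θ) * ((1 + θ) * (m + θ ^ 2) + (θ ^ 2 + θ) + (4 * D + θ ^ 2)) ≤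
      (1 + θ) * (m + 4 * D + θ * (A2 + 5)) := by gcongr
  linarith

/-! ### Oscillation -/

lemma bddAbove_osc_aux (f : V2) (t : I) (V : Set I) : BddAbove (range fun x : V => |f x - f t|) :=
  ⟨2 * ‖f‖, by rintro _ ⟨x, rfl⟩; exact f.abs_sub_le _ _⟩

lemma osc_aux_nonneg (f : I → ℝ) (t : I) (V : Set I) : 0 ≤ ⨆ x : V, |f x - f t| :=
  Real.iSup_nonneg fun _ => abs_nonneg _

lemma oscTilde_nonneg (f : I → ℝ) (t : I) : 0 ≤ oscTilde f t :=
  Real.iInf_nonneg fun _ => osc_aux_nonneg _ _ _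

lemma oscTilde_le (f : I → ℝ) (t : I) : oscTilde f t ≤ ⨆ x : (univ : Set I), |f x - f t| :=
  ciInf_le ⟨0, by rintro _ ⟨V, rfl⟩; exact osc_aux_nonneg _ _ _⟩
    (⟨univ, isOpen_univ, mem_univ t⟩ : {V : Set I // IsOpen V ∧ t ∈ V})

lemma abs_le_supNorm (f : V2) (t : I) : |f t| ≤ supNorm f :=
  le_ciSup (f := fun t => |f t|) ⟨‖f‖, by rintro _ ⟨x, rfl⟩; exact f.abs_apply_le_norm x⟩ t

lemma oscTilde_le_two_mul (f : V2) (t : I) : oscTilde f t ≤ 2 * supNorm f := by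
  refine (oscTilde_le f t).trans (ciSup_le fun x => ?_)
  have h1 := abs_le_supNorm f x
  have h2 := abs_le_supNorm f t
  have h3 := abs_sub (f x) (f t)
  linarith

lemma supNorm_oscTilde_le (f : V2) : supNorm (oscTilde f) ≤ 2 * supNorm f :=
  ciSup_le fun t => by rw [abs_of_nonneg (oscTilde_nonneg _ _)]; exact oscTilde_le_two_mul f t

lemma oscTilde_le_supNorm (f : V2) (t : I) : oscTilde f t ≤ supNorm (oscTilde f) := by
  refine le_trans (le_abs_self _) (le_ciSup (f := fun t => |oscTilde f t|) ?_ t)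
  refine ⟨2 * supNorm f, ?_⟩
  rintro _ ⟨x, rfl⟩
  simp only [abs_of_nonneg (oscTilde_nonneg f x)]
  exact oscTilde_le_two_mul f x

/-- By a Lebesgue number, every small ball lies in a neighbourhood of some `t` on which `f` is
compared with `f t`; passing through `f t` doubles the oscillation. -/
lemma exists_radius_oscTilde (f : V2) {ε : ℝ} (hε : 0 < ε) :
    ∃ r > 0, ∀ x, ∀ y ∈ Metric.ball x r, ∀ z ∈ Metric.ball x r,
      f y - f z ≤ 2 * supNorm (oscTilde f) + ε := by
  have h : ∀ t : I, ∃ V : Set I, IsOpen V ∧ t ∈ V ∧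
      ∀ x ∈ V, |f x - f t| ≤ supNorm (oscTilde f) + ε / 2 := by
    intro t
    have hlt : oscTilde f t < supNorm (oscTilde f) + ε / 2 := by
      have := oscTilde_le_supNorm f t; linarith
    have : Nonempty {V : Set I // IsOpen V ∧ t ∈ V} := ⟨⟨univ, isOpen_univ, mem_univ t⟩⟩
    obtain ⟨⟨V, hV, htV⟩, hlt⟩ := exists_lt_of_ciInf_lt hlt
    exact ⟨V, hV, htV, fun x hx => (le_ciSup (bddAbove_osc_aux f t V) ⟨x, hx⟩).trans hlt.le⟩
  choose V hV htV hle using h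
  obtain ⟨r, hr, hball⟩ := lebesgue_number_lemma_of_metric (isCompact_univ (X := I)) hV
    fun x _ => mem_iUnion.2 ⟨x, htV x⟩
  refine ⟨r, hr, fun x y hy z hz => ?_⟩
  obtain ⟨t, ht⟩ := hball x (mem_univ x)
  have h1 := abs_le.1 (hle t y (ht hy))
  have h2 := abs_le.1 (hle t z (ht hz))
  linarith

/-! ### Consequences of pointwise convergence -/

lemma convexHull_tail_anti {E : Type*} [AddCommGroup E] [Module ℝ E] (u : ℕ → E) {m n : ℕ}
    (h : m ≤ n) : convexHull ℝ (u '' Ici n) ⊆ convexHull ℝ (u '' Ici m) :=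
  convexHull_mono (image_mono (Ici_subset_Ici.2 h))

lemma tendsto_of_mem_convexHull {u : ℕ → V2} {t : I} {a : ℝ}
    (hlim : Tendsto (fun n => u n t) atTop (𝓝 a)) {h : ℕ → V2}
    (hh : ∀ n, h n ∈ convexHull ℝ (u '' Ici n)) : Tendsto (fun n => h n t) atTop (𝓝 a) := by
  rw [Metric.tendsto_atTop] at hlim ⊢
  intro ε hε
  obtain ⟨N, hN⟩ := hlim ε hε
  refine ⟨N, fun n hn => ?_⟩
  have hconv : Convex ℝ ((evalCLM t) ⁻¹' Metric.ball a ε) :=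
    (convex_ball a ε).linear_preimage (evalCLM t).toLinearMap
  exact convexHull_min (by rintro _ ⟨i, hi, rfl⟩; exact hN i (hn.trans hi)) hconv (hh n)

lemma tendsto_v2sq {u : ℕ → I → ℝ} {f : I → ℝ} (h : ∀ t, Tendsto (fun n => u n t) atTop (𝓝 (f t)))
    (P : Partition) : Tendsto (fun n => P.v2sq (u n)) atTop (𝓝 (P.v2sq f)) :=
  tendsto_finsetSum _ fun _ _ => ((h _).sub (h _)).pow 2

lemma tendsto_qv {u : ℕ → I → ℝ} {f : I → ℝ} (h : ∀ t, Tendsto (fun n => u n t) atTop (𝓝 (f t)))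
    (s : Finset (I × I)) : Tendsto (fun n => qv (u n) s) atTop (𝓝 (qv f s)) :=
  tendsto_finsetSum _ fun _ _ => ((h _).sub (h _)).pow 2

/-- Lower semicontinuity of the norm, uniformly over convex combinations of a tail. -/
lemma eventually_lt_norm_sub {f g : V2} {u : ℕ → V2}
    (hlim : ∀ t, Tendsto (fun n => u n t) atTop (𝓝 (f t))) {δ : ℝ} (hδ : δ < ‖f - g‖) :
    ∀ᶠ N in atTop, ∀ h ∈ convexHull ℝ (u '' Ici N), δ < ‖h - g‖ := by
  by_contra hcon
  have hcon' : ∀ N, ∃ h ∈ convexHull ℝ (u '' Ici N), ‖h - g‖ ≤ δ := by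
    intro N
    by_contra! h
    exact hcon (eventually_atTop.2 ⟨N, fun n hn k hk => h k (convexHull_tail_anti u hn hk)⟩)
  choose h hh hle using hcon'
  -- One partition already witnesses the strict inequality, and along it pointwise convergence of
  -- the offending `h N` suffices.
  obtain ⟨P, hP⟩ := exists_lt_of_lt_ciSup (show δ < ⨆ P : Partition, √(P.v2sq ⇑(f - g)) from hδ)
  have hl : Tendsto (fun n => √(P.v2sq ⇑(h n - g))) atTop (𝓝 √(P.v2sq ⇑(f - g))) :=
    (tendsto_v2sq (fun t => (tendsto_of_mem_convexHull (hlim t) hh).sub_const (g t)) P).sqrt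
  obtain ⟨n, hn⟩ := (hl.eventually (lt_mem_nhds hP)).exists
  exact absurd (hn.trans_le (((h n - g).sqrt_v2sq_le_norm P).trans (hle n))) (lt_irrefl _)

/-- On an open set, the quadratic variation of `h_l - h_k` exceeds every number below its
`μ_f`-measure. -/
lemma exists_intervalFamily_lt (f : V2) {h : ℕ → V2} (hh : ∀ n, h n ∈ V20)
    (hlim : ∀ t, Tendsto (fun n => h n t) atTop (𝓝 (f t))) (k : ℕ) {V : Set I} (hV : IsOpen V)
    {θ : ℝ} (hθ : 0 < θ) (hθV : θ < (mu f).real V) :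
    ∃ (J : IntervalFamily) (l : ℕ), J.union ⊆ V ∧ k < l ∧ θ < J.v2sq (h l - h k) := by
  obtain ⟨θ', hθ1, hθ2⟩ := exists_between hθV
  -- Chosen so that `(1 + τ) * θ + (θ' - θ) / 2 = θ'`: the second term pays for `h k`.
  set τ := (θ' - θ) / (2 * θ) with hτ
  have hκ : 0 < θ' - θ := sub_pos.2 hθ1
  have hτ0 : 0 < τ := by positivity
  have hτθ : τ * θ = (θ' - θ) / 2 := by rw [hτ]; field_simp
  obtain ⟨η, hη, hfine⟩ := SquareAbsCont.exists_fine (hh k)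
    (show 0 < (θ' - θ) / 2 / (1 + τ⁻¹) by positivity)
  obtain ⟨s, hs, hsf, hsV, hlt⟩ := exists_fam_of_lt_mu f hV hθ2 hη
  have h1 := hfine s hs hsf
  rw [lt_div_iff₀ (by positivity)] at h1
  have h2 := qv_add_le hτ0 (⇑f - ⇑(h k)) (h k) s
  rw [sub_add_cancel] at h2
  have h3 : θ < qv (⇑f - ⇑(h k)) s := by
    by_contra! hle
    have : (1 + τ) * qv (⇑f - ⇑(h k)) s ≤ (1 + τ) * θ := by gcongr
    linarith
  have h4 : Tendsto (fun n => qv (⇑(h n) - ⇑(h k)) s) atTop (𝓝 (qv (⇑f - ⇑(h k)) s)) :=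
    tendsto_qv (fun t => (hlim t).sub_const _) s
  obtain ⟨l, hl, hkl⟩ := ((h4.eventually (lt_mem_nhds h3)).and (eventually_gt_atTop k)).exists
  obtain ⟨J, hJ1, hJ2⟩ := hs.exists_intervalFamily
  refine ⟨J, l, hJ2 ▸ hsV, hkl, ?_⟩
  rw [hJ1]
  exact hl

/-! ### Selecting the convex blocks -/

lemma Near.sub_le {f g h : I → ℝ} {r ε B : ℝ} (hg : Near f r ε g) (hh : Near f r ε h)
    (hB : ∀ x, ∀ y ∈ Metric.ball x r, ∀ z ∈ Metric.ball x r, f y - f z ≤ B) (x : I) :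
    |g x - h x| ≤ B + 2 * ε := by
  obtain ⟨⟨y, hy, h1⟩, ⟨z, hz, h2⟩⟩ := hg x
  obtain ⟨⟨y', hy', h1'⟩, ⟨z', hz', h2'⟩⟩ := hh x
  have h3 := hB x y hy z' hz'
  have h4 := hB x y' hy' z hz
  rw [abs_le]; constructor <;> linarith

/-- Writing `g - h` as `(f - h) - (f - g)` gives `4 μ_f(hull s) + 16 D + 4 ε` with `D = ‖μ_f^d‖`.
Endpoints missing from the carriers cost another `4 D`, and `20 D ≤ 32 ‖f‖ √D` because `D ≤ ‖f‖ ^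
2`. -/
lemma isDominatedBy_of_qv_le {f g h : V2} {ε : ℝ}
    (hg : ∀ s, IsFam s → qv (⇑f - ⇑g) s ≤
      (mu f).real (hull s) + 4 * (discretePart (mu f)).real univ + ε)
    (hh : ∀ s, IsFam s → qv (⇑f - ⇑h) s ≤
      (mu f).real (hull s) + 4 * (discretePart (mu f)).real univ + ε) :
    IsDominatedBy (g - h) 4 (32 * ‖f‖ * √((discretePart (mu f)).real univ) + 4 * ε) (mu f) := by
  intro F
  obtain ⟨s, hs, hqv, E, hE, hsub⟩ := F.exists_isFam
  set D := (discretePart (mu f)).real univ with hD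
  have hD0 : 0 ≤ D := measureReal_nonneg
  have hDle : D ≤ ‖f‖ ^ 2 := (discretePart_le _).trans (by rw [mu_univ]; exact muTilde_univ_le f)
  have hsq : √D ≤ ‖f‖ := Real.sqrt_le_iff.2 ⟨norm_nonneg _, hDle⟩
  have hDD : D ≤ ‖f‖ * √D := by
    calc D = √D * √D := (Real.mul_self_sqrt hD0).symm
      _ ≤ ‖f‖ * √D := by gcongr
  have hfD : 0 ≤ ‖f‖ * √D := by positivity
  have h1 : (mu f).real (hull s) ≤ (mu f).real F.union + D :=
    (measureReal_mono hsub).trans ((measureReal_union_le _ _).trans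
      (by gcongr; exact measure_finite_le_discrete _ hE))
  have h2 := qv_add_le one_pos (⇑f - ⇑h) (-(⇑f - ⇑g)) s
  rw [qv_neg, inv_one, show (⇑f - ⇑h) + -(⇑f - ⇑g) = ⇑(g - h) by rw [V2.coe_sub]; abel, hqv] at h2
  have h3 := hg s hs
  have h4 := hh s hs
  linarith

/-- The data of one convex block: the vector, its support and weights, a lower bound of the
support, and a radius. -/
structure BlockData where
  idx : ℕ
  rad : ℝ
  vec : V2
  supp : Finset ℕ
  wt : ℕ → ℝ

/-- Running minima. The tolerance of the `n`-th block is taken at its tail index, which is at least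
`n`, so monotonicity is needed to compare it with `ε n`. -/
lemma exists_antitone_pos_le {ε : ℕ → ℝ} (hε : ∀ n, 0 < ε n) :
    ∃ ε' : ℕ → ℝ, Antitone ε' ∧ (∀ n, 0 < ε' n) ∧ ∀ n, ε' n ≤ ε n :=
  ⟨fun n => (Finset.range (n + 1)).inf' Finset.nonempty_range_add_one ε,
    fun m n hmn => Finset.inf'_mono _ (Finset.range_subset_range.2 (by omega)) _,
    fun n => (Finset.lt_inf'_iff _).2 fun i _ => hε i,
    fun n => Finset.inf'_le _ (Finset.mem_range.2 (by omega))⟩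

/-- The supports are disjoint, so the weights of the separate blocks glue to one function. -/
lemma isConvexBlockSeq_of_blockData {u : ℕ → V2} {b : ℕ → BlockData}
    (hlt : ∀ n m, n < m → ∀ i ∈ (b n).supp, ∀ j ∈ (b m).supp, i < j)
    (hw : ∀ n i, 0 ≤ (b n).wt i) (hw1 : ∀ n, ∑ i ∈ (b n).supp, (b n).wt i = 1)
    (hvec : ∀ n, (b n).vec = ∑ i ∈ (b n).supp, (b n).wt i • u i) :
    IsConvexBlockSeq u fun n => (b n).vec := by
  classical
  have key : ∃ w : ℕ → ℝ, (∀ i, 0 ≤ w i) ∧ ∀ n, ∀ i ∈ (b n).supp, w i = (b n).wt i := by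
    refine ⟨fun i => if h : ∃ n, i ∈ (b n).supp then (b h.choose).wt i else 0, fun i => ?_,
      fun n i hi => ?_⟩
    · beta_reduce
      split_ifs
      · exact hw _ _
      · exact le_rfl
    · have h : ∃ n, i ∈ (b n).supp := ⟨n, hi⟩
      have hn : h.choose = n := by
        rcases lt_trichotomy h.choose n with h' | h' | h'
        · exact absurd (hlt _ _ h' i h.choose_spec i hi) (lt_irrefl _)
        · exact h'
        · exact absurd (hlt _ _ h' i hi i h.choose_spec) (lt_irrefl _)
      simp only [dif_pos h, hn]
  obtain ⟨w, hw0, hwe⟩ := key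
  refine ⟨fun n => (b n).supp, w, hlt, hw0, fun n => ?_, fun n => ?_⟩
  · rw [← hw1 n]; exact Finset.sum_congr rfl fun i hi => hwe n i hi
  · dsimp only
    rw [hvec n]
    exact Finset.sum_congr rfl fun i hi => by rw [hwe n i hi]

/-- Each new block is compared with all earlier ones: a late tail gives the lower norm bound and the
order of the supports, and a smaller radius makes the new vector near `f` at the earlier radii too.
-/
lemma exists_blockData (f : V2) {u : ℕ → V2} {X : Submodule ℝ V2} (hX : X ≤ V20)
    (huX : ∀ n, u n ∈ X) (hbdd : BddAbove (range fun n => ‖u n‖))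
    (hlim : ∀ t, Tendsto (fun n => u n t) atTop (𝓝 (f t))) {δ : ℝ}
    (hδ : δ < Metric.infDist f (X : Set V2)) {ε : ℕ → ℝ} (hε : ∀ n, 0 < ε n) :
    ∃ b : ℕ → BlockData,
      (∀ n, (b n).vec ∈ convexHull ℝ (u '' Ici (b n).idx) ∧ (∀ i, 0 ≤ (b n).wt i) ∧
        ∑ i ∈ (b n).supp, (b n).wt i = 1 ∧ (b n).vec = ∑ i ∈ (b n).supp, (b n).wt i • u i ∧
        Near f (b n).rad (ε (b n).idx) (b n).vec ∧
        (∀ x, ∀ y ∈ Metric.ball x (b n).rad, ∀ z ∈ Metric.ball x (b n).rad,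
          f y - f z ≤ 2 * supNorm (oscTilde f) + ε (b n).idx) ∧
        ∀ s, IsFam s → qv (⇑f - ⇑(b n).vec) s ≤
          (mu f).real (hull s) + 4 * (discretePart (mu f)).real univ + ε (b n).idx) ∧
      ∀ n m, n < m → (b n).idx < (b m).idx ∧ (∀ i ∈ (b n).supp, ∀ j ∈ (b m).supp, i < j) ∧
        (b m).rad ≤ (b n).rad ∧ δ < ‖(b m).vec - (b n).vec‖ := by
  refine (exists_seq_of_forall_finset_exists
    (fun b : BlockData => 0 < b.rad ∧ b.vec ∈ convexHull ℝ (u '' Ici b.idx) ∧ (∀ i, 0 ≤ b.wt i) ∧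
        ∑ i ∈ b.supp, b.wt i = 1 ∧ b.vec = ∑ i ∈ b.supp, b.wt i • u i ∧
        Near f b.rad (ε b.idx) b.vec ∧
        (∀ x, ∀ y ∈ Metric.ball x b.rad, ∀ z ∈ Metric.ball x b.rad,
          f y - f z ≤ 2 * supNorm (oscTilde f) + ε b.idx) ∧
        ∀ s, IsFam s → qv (⇑f - ⇑b.vec) s ≤
          (mu f).real (hull s) + 4 * (discretePart (mu f)).real univ + ε b.idx)
    (fun b c : BlockData => b.idx < c.idx ∧ (∀ i ∈ b.supp, ∀ j ∈ c.supp, i < j) ∧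
        c.rad ≤ b.rad ∧ δ < ‖c.vec - b.vec‖) ?_).imp
    fun b hb => ⟨fun n => (hb.1 n).2, hb.2⟩
  intro s hs
  have hN : ∀ᶠ N in atTop, ∀ b ∈ s, b.idx < N ∧ (∀ i ∈ b.supp, i < N) ∧
      ∀ h ∈ convexHull ℝ (u '' Ici N), δ < ‖h - b.vec‖ := by
    rw [Finset.eventually_all]
    intro b hb
    refine (eventually_gt_atTop _).and (Eventually.and ?_ (eventually_lt_norm_sub hlim ?_))
    · rw [Finset.eventually_all]
      exact fun i _ => eventually_gt_atTop i
    · refine hδ.trans_le ?_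
      rw [← dist_eq_norm]
      exact Metric.infDist_le_dist_of_mem (mem_of_mem_convexHull huX (hs b hb).2.1)
  obtain ⟨N, hN⟩ := hN.exists
  have hr : ∀ᶠ r in 𝓝[>] (0 : ℝ), ∀ b ∈ s, r ≤ b.rad := by
    rw [Finset.eventually_all]
    exact fun b hb => mem_nhdsWithin_of_mem_nhds (Iic_mem_nhds (hs b hb).1)
  obtain ⟨r, hr, hr0⟩ := (hr.and self_mem_nhdsWithin).exists
  have hr0 : 0 < r := hr0
  obtain ⟨r', hr'0, hr'⟩ := exists_radius_oscTilde f (hε N)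
  obtain ⟨h, hh, hnear, hqv⟩ := exists_convexHull_qv_le f (fun n => hX (huX n)) hbdd hlim
    (lt_min hr0 hr'0) (hε N) N
  obtain ⟨S, w, hS, hw, hw1, hsum⟩ := exists_weights hh
  refine ⟨⟨N, min r r', h, S, w⟩, ⟨lt_min hr0 hr'0, hh, hw, hw1, hsum, hnear, ?_, hqv⟩, ?_⟩
  · intro x y hy z hz
    exact hr' x y (Metric.ball_subset_ball (min_le_right _ _) hy) z
      (Metric.ball_subset_ball (min_le_right _ _) hz)
  · intro b hb
    obtain ⟨h1, h2, h3⟩ := hN b hb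
    exact ⟨h1, fun i hi j hj => (h2 i hi).trans_le (hS j hj), (min_le_left _ _).trans (hr b hb),
      h3 h hh⟩

lemma IsDominatedBy.mono {G : V2} {C ε ε' : ℝ} {μ : Measure I} (h : IsDominatedBy G C ε μ)
    (hε : ε ≤ ε') : IsDominatedBy G C ε' μ := fun F => (h F).trans (by linarith)

end QuadVar

/-! ### Assembly of the proposition -/

open QuadVar
theorem proposition4p5
    (X : Submodule ℝ V2) (hXclosed : IsClosed (X : Set V2)) (hX : X ≤ V20)
    (f : V2) (hf : f ∈ bidual X) (hfX : f ∉ X)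
    (u : ℕ → V2) (huX : ∀ n, u n ∈ X) (hubdd : BddAbove (range fun n => ‖u n‖))
    (hulim : ∀ t : unitInterval, Tendsto (fun n => u n t) atTop (𝓝 (f t)))
    (δ : ℝ) (hδ : 0 < δ) (hδf : δ < Metric.infDist f (X : Set V2))
    (ε : ℕ → ℝ) (hε : ∀ n, 0 < ε n) :
    ∃ h : ℕ → V2, IsConvexBlockSeq u h ∧
      (∀ n m, n < m →
        (δ < ‖h m - h n‖ ∧ ‖h m - h n‖ ≤ 2 * ⨆ i, ‖u i‖) ∧
        (supNorm (h m - h n) ≤ 2 * supNorm (oscTilde f) + ε n ∧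
          2 * supNorm (oscTilde f) + ε n ≤ 4 * supNorm f + ε n) ∧
        IsDominatedBy (h m - h n) 4
          (32 * ‖f‖ * √((discretePart (mu f)).real univ) + ε n) (mu f)) ∧
      (∀ (k : ℕ) (V : Set unitInterval) (θ : ℝ), IsOpen V → 0 < θ → θ < (mu f).real V →
        ∃ (J : IntervalFamily) (l : ℕ), J.union ⊆ V ∧ k < l ∧ θ < J.v2sq (h l - h k)) := by
  -- A quarter, because domination of a difference costs four tolerances; the supremum bound needs
  -- three.
  obtain ⟨ε', hanti, hpos, hle⟩ := exists_antitone_pos_le (ε := fun n => ε n / 4)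
    fun n => div_pos (hε n) four_pos
  obtain ⟨b, hb, hlt⟩ := exists_blockData f hX huX hubdd hulim hδf hpos
  have hidx : ∀ n, n ≤ (b n).idx := fun _ =>
    (strictMono_nat_of_lt_succ fun n => (hlt n (n + 1) n.lt_succ_self).1).le_apply
  have hmem : ∀ n, (b n).vec ∈ convexHull ℝ (u '' Ici n) := fun n =>
    convexHull_tail_anti u (hidx n) (hb n).1
  refine ⟨fun n => (b n).vec, isConvexBlockSeq_of_blockData (fun n m h => (hlt n m h).2.1)
    (fun n => (hb n).2.1) (fun n => (hb n).2.2.1) (fun n => (hb n).2.2.2.1), ?_, ?_⟩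
  · intro n m hnm
    obtain ⟨h1, -, h2, h3⟩ := hlt n m hnm
    obtain ⟨-, -, -, -, hnear, hrad, hqv⟩ := hb n
    obtain ⟨-, -, -, -, hnear', -, hqv'⟩ := hb m
    have hεmn : ε' (b m).idx ≤ ε' (b n).idx := hanti h1.le
    have hεn : ε' (b n).idx ≤ ε n / 4 := (hanti (hidx n)).trans (hle n)
    have hεn0 := hε n
    refine ⟨⟨h3, ?_⟩, ⟨?_, ?_⟩, ?_⟩
    · have hM : ∀ i, ‖u i‖ ≤ ⨆ i, ‖u i‖ := fun i => le_ciSup hubdd i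
      have h4 := norm_sub_le (b m).vec (b n).vec
      have h5 := norm_le_of_mem_convexHull hM (hmem n)
      have h6 := norm_le_of_mem_convexHull hM (hmem m)
      linarith
    · refine ciSup_le fun x => ?_
      have h4 := (hnear'.mono h2 hεmn).sub_le hnear hrad x
      simp only [Pi.sub_apply]
      linarith
    · have := supNorm_oscTilde_le f
      linarith
    · exact (isDominatedBy_of_qv_le (fun s hs => (hqv' s hs).trans (by linarith)) hqv).mono
        (by linarith)
  · intro k V θ hV hθ hθV
    exact exists_intervalFamily_lt f (fun n => hX (mem_of_mem_convexHull huX (hmem n)))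
      (fun t => tendsto_of_mem_convexHull (hulim t) hmem) k hV hθ hθV
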